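/- Let $\Omega=\{0,1\}^{\mathbb Z}$ with the product $\sigma$-algebra, and define $T:\Omega\to\Omega$ by $(T\omega)_i=\omega_i\bigl(1-(1-\omega_{i-1})(1-\omega_{i+1})\bigr)$ (isolated ones are erased). Let $\Omega'=T(\Omega)$ with the trace $\sigma$-algebra and, for $\Delta\subset\mathbb Z$, let $\mathcal F'_\Delta$ be the trace on $\Omega'$ of the $\sigma$-algebra generated by the spins in $\Delta$; write $\mathcal F'_{\le x}=\mathcal F'_{(-\infty,x]}$ and $\mathcal F'_{<x}=\mathcal F'_{(-\infty,x)}$. For $p\in(0,1)$ let $\mu_p=\mathrm{Ber}(p)^{\otimes\mathbb Z}$ and let $\mu'_p=\mu_p\circ T^{-1}$, a probability measure on $\Omega'$ (the thinned Bernoulli field). A *left interval-specification* (LIS) on $\Omega'$ is a family of probability kernels $\rho_\Lambda(A\mid\omega)$, $A\in\mathcal F'_{\le m}$, $\omega\in\Omega'$, indexed by the nonempty finite intervals $\Lambda=[l,m]\subset\mathbb Z$, such that $\rho_\Lambda(A\mid\cdot)$ is $\mathcal F'_{<l}$-measurable for every $A\in\mathcal F'_{\le m}$, $\rho_\Lambda(B\mid\omega)=\mathbf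 1_B(\omega)$ for every $B\in\mathcal F'_{<l}$, and $\rho_{\Delta}\rho_\Lambda f=\rho_\Delta f$ whenever $\Lambda=[l,m]\subset\Delta$ and $f\ge 0$ is $\mathcal F'_{\le m}$-measurable. A probability measure $\nu$ on $\Omega'$ is *consistent* with the family if $\nu\rho_\Lambda f=\nu f$ for all $\Lambda=[l,m]$ and all $\mathcal F'_{\le m}$-measurable $f\ge 0$. Put $$\lambda_{\rm r}=\tfrac12\Bigl(1-p-\sqrt{(1-p)(3p+1)}\Bigr),\qquad \lambda_{\rm PF}=\tfrac12\Bigl(1-p+\sqrt{(1-p)(3p+1)}\Bigr),\qquad a=\lambda_{\rm r}/\lambda_{\rm PF}.$$ Define $g_p(0)=0$, $g_p(1)=1-p$ and, for $n\in\{2,3,\dots\}\cup\{\infty\}$, $$g_p(n)=\frac{(-1)^{n+1}|a|^n\frac{\lambda_{\rm PF}}{1-\lambda_{\rm r}}+\frac{\lambda_{\rm PF}}{1-\lambda_{\rm PF}}}{(-1)^n|a|^{n-1}\frac1{1-\lambda_{\rm r}}+\frac1{1-\lambda_{\rm PF}}},$$ where for $n=\infty$ the terms containing powers of $|a|$ are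 $0$. For a configuration $\omega$ and $i\in\mathbb Z$ let $n_i(\omega)=0$ if $(\omega_{i-2},\omega_{i-1})=(0,1)$, and otherwise $n_i(\omega)=\min\{k\ge1:(\omega_{i-k-1},\omega_{i-k})=(1,1)\}$, with $\min\emptyset=\infty$. Let $\rho_p$ be the family whose kernel $\rho_{p,[l,m]}(\cdot\mid\omega)$ keeps $\omega_{(-\infty,l)}$ and gives the spins $x\in\{0,1\}^{[l,m]}$ the probability $\prod_{i=l}^m w_i$, where, with $n_i$ computed from the concatenation of $\omega_{(-\infty,l)}$ and $x$, $w_i=g_p(n_i)$ if $x_i=0$ and $w_i=1-g_p(n_i)$ if $x_i=1$. Then, for every $p\in(0,1)$: $\rho_p$ is an LIS on $\Omega'$; its single-site kernels are given by the $g$-function $g_p$, that is, $\rho_{p,\{i\}}(\sigma_i=0\mid\omega)=g_p(n_i(\omega))$ for all $i\in\mathbb Z$ and $\omega\in\Omega'$, where $\sigma_i$ denotes the spin at $i$; and $\rho_p$ has exactly one consistent probability measure on $\Omega'$ (no translation invariance being assumed), namely the thinned Bernoulli field $\mu'_p$. -/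

import Mathlib

open MeasureTheory Set
open scoped ENNReal

noncomputable section

namespace TBF

/-- Spin configurations on `ℤ`; `true` means occupied (`1`), `false` means unoccupied (`0`).
It carries the product `σ`-algebra. -/
abbrev Config : Type := ℤ → Bool

/-- The projection `T` to non-isolation: an occupied site stays occupied iff at least one of its
two nearest neighbours is occupied. -/
def thin (ω : Config) : Config := fun i => ω i && (ω (i - 1) || ω (i + 1))

/-- The second-layer space `Ω' = T(Ω)`, with the trace of the product `σ`-algebra. -/
abbrev Config' : Type := ↥(range thin)

/-- `T`, regarded as a map onto `Ω'`. -/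
def thin' : Config → Config' := rangeFactorization thin

/-- The trace on `Ω'` of the `σ`-algebra generated by the spins at the sites in `Δ`. -/
abbrev sigmaOn (Δ : Set ℤ) : MeasurableSpace Config' :=
  (cylinderEvents (X := fun _ : ℤ => Bool) Δ).comap Subtype.val

/-- The `σ`-algebra of the spins at the sites `≤ x`. -/
abbrev sigmaLE (x : ℤ) : MeasurableSpace Config' := sigmaOn (Iic x)

/-- The `σ`-algebra of the spins at the sites `< x`. -/
abbrev sigmaLT (x : ℤ) : MeasurableSpace Config' := sigmaOn (Iio x)

/-- The Bernoulli product measure `μ_p` on `{0,1}^ℤ`. -/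
def bernoulliField (p : unitInterval) : Measure Config :=
  Measure.infinitePi fun _ : ℤ => ProbabilityTheory.bernoulliMeasure true false p

/-- The thinned Bernoulli field `μ'_p = μ_p ∘ T⁻¹` on `Ω'`. -/
def thinnedField (p : unitInterval) : Measure Config' := (bernoulliField p).map thin'

/-! ### Left interval-specifications -/

/-- A family `ρ l m ω = ρ_{[l,m]}(· | ω)` of measures on the spins up to `m`, given `ω ∈ Ω'`.
Only the nonempty intervals `l ≤ m` matter. -/
abbrev KernelFamily : Type := ∀ (_ m : ℤ), Config' → @Measure Config' (sigmaLE m)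

/-- `ρ` is a left interval-specification on `Ω'`. -/
structure IsLIS (ρ : KernelFamily) : Prop where
  prob : ∀ l m : ℤ, l ≤ m → ∀ ω, ρ l m ω univ = 1
  measurable : ∀ l m : ℤ, l ≤ m → ∀ A : Set Config', MeasurableSet[sigmaLE m] A →
    Measurable[sigmaLT l] fun ω => ρ l m ω A
  proper : ∀ l m : ℤ, l ≤ m → ∀ B : Set Config', MeasurableSet[sigmaLT l] B →
    ∀ ω, ρ l m ω B = B.indicator 1 ω
  consistent : ∀ l m l' m' : ℤ, l ≤ m → l' ≤ l → m ≤ m' →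
    ∀ f : Config' → ℝ≥0∞, Measurable[sigmaLE m] f →
    ∀ ω, ∫⁻ η, (∫⁻ ξ, f ξ ∂(ρ l m η)) ∂(ρ l' m' ω) = ∫⁻ ξ, f ξ ∂(ρ l' m' ω)

/-- `ν` is a probability measure on `Ω'` that is consistent with the family `ρ`. -/
structure IsConsistent (ρ : KernelFamily) (ν : Measure Config') : Prop where
  prob : IsProbabilityMeasure ν
  consistent : ∀ l m : ℤ, l ≤ m → ∀ f : Config' → ℝ≥0∞, Measurable[sigmaLE m] f →
    ∫⁻ ω, (∫⁻ ξ, f ξ ∂(ρ l m ω)) ∂ν = ∫⁻ ω, f ω ∂ν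

/-! ### The `g`-function -/

/-- The distance `n_i(ω)` from `i` to the nearest pair of ones in the past of `i`: it is `0` if
`(ω_{i-2}, ω_{i-1}) = (0,1)`, and otherwise the least `k ≥ 1` with
`(ω_{i-k-1}, ω_{i-k}) = (1,1)`, which is `⊤` if there is no such `k`. -/
def pairDist (ω : Config) (i : ℤ) : ℕ∞ :=
  open Classical in
  if ω (i - 2) = false ∧ ω (i - 1) = true then 0
  else ⨅ k ∈ {k : ℕ | 1 ≤ k ∧ ω (i - k - 1) = true ∧ ω (i - k) = true}, (k : ℕ∞)

/-- The smaller eigenvalue of the transfer matrix `[[1-p, √(p(1-p))], [√(p(1-p)), 0]]`. -/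
def lamR (p : ℝ) : ℝ := (1 - p - √((1 - p) * (3 * p + 1))) / 2

/-- The Perron-Frobenius eigenvalue of the same matrix. -/
def lamPF (p : ℝ) : ℝ := (1 - p + √((1 - p) * (3 * p + 1))) / 2

/-- The eigenvalue ratio. -/
def ratio (p : ℝ) : ℝ := lamR p / lamPF p

/-- The function `g_p` on `ℕ ∪ {∞}`; at `∞` the powers of `|a|` vanish (`|a| < 1`). -/
def gFun (p : ℝ) : ℕ∞ → ℝ
  | ⊤ => (lamPF p / (1 - lamPF p)) / (1 / (1 - lamPF p))
  | (0 : ℕ) => 0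
  | (1 : ℕ) => 1 - p
  | (n + 2 : ℕ) =>
    ((-1) ^ (n + 3) * |ratio p| ^ (n + 2) * (lamPF p / (1 - lamR p)) + lamPF p / (1 - lamPF p)) /
      ((-1) ^ (n + 2) * |ratio p| ^ (n + 1) * (1 / (1 - lamR p)) + 1 / (1 - lamPF p))

/-- The probability of the spin `b` given that the nearest pair of ones is at distance `n`:
`g_p(n)` for `b = 0` and `1 - g_p(n)` for `b = 1`. -/
def spinProb (p : ℝ) (n : ℕ∞) (b : Bool) : ℝ := if b then 1 - gFun p n else gFun p n

/-- The configuration equal to `ω` to the left of `[l,m]`, to `x` on `[l,m]`, and occupied to the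
right of `[l,m]`. -/
def splice (l m : ℤ) (ω : Config) (x : Finset.Icc l m → Bool) : Config := fun j =>
  if h : j ∈ Finset.Icc l m then x ⟨j, h⟩ else if j < l then ω j else true

/-- The LIS `ρ_p` with `g`-function `g_p`: the spins in `[l,m]` are drawn one after the other from
left to right, the spin at `i` having law `spinProb p n_i`. The kernel only records the spins up to
`m`, so the ones put to the right of `m` are irrelevant; and `thin'` only serves to obtain an
element of `Ω'`, as it fixes `splice l m ω x` whenever the weight of `x` is positive. -/
def lis (p : ℝ) : KernelFamily := fun l m ω =>
  ∑ x : Finset.Icc l m → Bool,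
    ENNReal.ofReal (∏ i : Finset.Icc l m, spinProb p (pairDist (splice l m ω x) i) (x i)) •
      @Measure.dirac Config' (sigmaLE m) (thin' (splice l m ω x))

end TBF

end

noncomputable section

namespace TBF

/-! Call two adjacent ones a pair. Thinning keeps all pairs and creates none. Given a pair at `(k -
1, k)`, the Bernoulli spins up to `k` and beyond `k` are independent, and for `n ≥ 1` the thinned
field vanishes on the next `n` sites iff `k + 1` is empty and the `n` sites from `k + 2` on carry no
pair. This has probability `gapWeight p n`, so after a gap of length `n` the next thinned spin is
zero with probability `gapWeight p (n + 1) / gapWeight p n`. Diagonalising the two-term recursion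
for `noPairWeight` identifies this quotient with `g_p(n + 1)` (`gFun_mul_gapWeight`).

LIS property: the kernels are compositions of single-site averages (`lintegral_lis`), and averaging
over later spins does not change a function of the past. The weights of `x` never erase a spin with
positive probability, because `g_p(0) = 0`.

Consistency of the thinned field: by composition one site suffices (`lintegral_step_thinnedField`).
Split according to the distance to the last pair. At distance `0` the next spin is forced, distance
`∞` is a null event, and at a positive finite distance the independence above applies
(`setLIntegral_step_of_pair`).

Uniqueness: ones have conditional probability at least some `ε > 0`, and a pair screens off
everything to its left. Hence sampling two further spins shrinks the oscillation of the conditional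
expectation of a local function by the factor `1 - ε ^ 2` (`exists_bounds_steps_two`). Far from the
local window the past is forgotten, so all consistent measures agree on cylinders, whether or not
they are translation invariant. -/

/-! ### The transfer recursion and the `g`-function -/

/-- The probability that `n` consecutive sites of the Bernoulli field carry no two adjacent ones. -/
def noPairWeight (p : ℝ) : ℕ → ℝ
  | 0 => 1
  | 1 => 1
  | n + 2 => (1 - p) * noPairWeight p (n + 1) + p * (1 - p) * noPairWeight p n

/-- The probability that the thinned field vanishes on the `n` sites following a pair of ones. -/
def gapWeight (p : ℝ) : ℕ → ℝ
  | 0 => 1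
  | n + 1 => (1 - p) * noPairWeight p (n + 1)

section Algebra

variable {p : ℝ}

lemma noPairWeight_pos (hp : p ∈ Ioo (0 : ℝ) 1) : ∀ n, 0 < noPairWeight p n
  | 0 => one_pos
  | 1 => one_pos
  | n + 2 => by
    have h1 := noPairWeight_pos hp (n + 1)
    have h0 := noPairWeight_pos hp n
    have := hp.1
    have : 0 < 1 - p := sub_pos.2 hp.2
    rw [noPairWeight]
    positivity

/-- Among `n + 3` sites, the left side is the probability that the first pair sits at the very end:
no pair on `n` sites, then `0, 1, 1`. -/
lemma noPairWeight_sub (n : ℕ) :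
    noPairWeight p (n + 2) - noPairWeight p (n + 3) = p ^ 2 * (1 - p) * noPairWeight p n := by
  have h : noPairWeight p (n + 3) =
    (1 - p) * noPairWeight p (n + 2) + p * (1 - p) * noPairWeight p (n + 1) := rfl
  have h' : noPairWeight p (n + 2) =
    (1 - p) * noPairWeight p (n + 1) + p * (1 - p) * noPairWeight p n := rfl
  rw [h, h']
  ring

lemma noPairWeight_anti (hp : p ∈ Ioo (0 : ℝ) 1) : ∀ n, noPairWeight p (n + 1) ≤ noPairWeight p n
  | 0 => le_rfl
  | 1 => by
    have := hp.1
    simp only [noPairWeight]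
    nlinarith
  | n + 2 => by
    have h := noPairWeight_sub (p := p) n
    have h1 := noPairWeight_pos hp n
    have := hp.1
    have : 0 < 1 - p := sub_pos.2 hp.2
    have : 0 < p ^ 2 * (1 - p) * noPairWeight p n := by positivity
    linarith

/-- Cutting the sites into `n` disjoint blocks of length two, no block may be a pair. The proof gets
the same bound from the recursion and monotonicity. -/
lemma noPairWeight_two_mul_le (hp : p ∈ Ioo (0 : ℝ) 1) (n : ℕ) :
    noPairWeight p (2 * n) ≤ (1 - p ^ 2) ^ n := by
  have h0 := hp.1
  have h1 := hp.2
  induction n with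
  | zero => simp [noPairWeight]
  | succ n ih =>
    have h : noPairWeight p (2 * (n + 1)) =
      (1 - p) * noPairWeight p (2 * n + 1) + p * (1 - p) * noPairWeight p (2 * n) := rfl
    have ha := noPairWeight_anti hp (2 * n)
    calc noPairWeight p (2 * (n + 1))
        ≤ (1 - p) * noPairWeight p (2 * n) + p * (1 - p) * noPairWeight p (2 * n) := by
          rw [h]
          have : 0 ≤ 1 - p := by linarith
          gcongr
      _ = noPairWeight p (2 * n) * (1 - p ^ 2) := by ring
      _ ≤ (1 - p ^ 2) ^ n * (1 - p ^ 2) := by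
          have : 0 ≤ 1 - p ^ 2 := by nlinarith
          gcongr
      _ = _ := by ring

lemma gapWeight_pos (hp : p ∈ Ioo (0 : ℝ) 1) : ∀ n, 0 < gapWeight p n
  | 0 => one_pos
  | _ + 1 => mul_pos (sub_pos.2 hp.2) (noPairWeight_pos hp _)

lemma gapWeight_anti (hp : p ∈ Ioo (0 : ℝ) 1) : ∀ n, gapWeight p (n + 1) ≤ gapWeight p n
  | 0 => by
    have := hp.1
    simp only [gapWeight, noPairWeight]
    linarith
  | _ + 1 => by
    simp only [gapWeight]
    exact mul_le_mul_of_nonneg_left (noPairWeight_anti hp _) (sub_pos.2 hp.2).le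

/-! ### Eigenvalues of the transfer matrix and the closed form of `g_p`. -/

lemma sqrt_disc_bounds (hp : p ∈ Ioo (0 : ℝ) 1) :
    1 - p < √((1 - p) * (3 * p + 1)) ∧ √((1 - p) * (3 * p + 1)) < 1 + p := by
  obtain ⟨h0, h1⟩ := hp
  constructor
  · apply Real.lt_sqrt_of_sq_lt
    nlinarith
  · rw [Real.sqrt_lt' (by linarith)]
    nlinarith

lemma lamR_neg (hp : p ∈ Ioo (0 : ℝ) 1) : lamR p < 0 := by
  have := (sqrt_disc_bounds hp).1
  rw [lamR]
  linarith

lemma lamPF_pos (hp : p ∈ Ioo (0 : ℝ) 1) : 0 < lamPF p := by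
  have := (sqrt_disc_bounds hp).1
  have := hp.2
  rw [lamPF]
  linarith

lemma lamPF_lt_one (hp : p ∈ Ioo (0 : ℝ) 1) : lamPF p < 1 := by
  have := (sqrt_disc_bounds hp).2
  rw [lamPF]
  linarith

lemma lamPF_sq (hp : p ∈ Ioo (0 : ℝ) 1) : lamPF p ^ 2 = (1 - p) * lamPF p + p * (1 - p) := by
  have h : √((1 - p) * (3 * p + 1)) ^ 2 = (1 - p) * (3 * p + 1) :=
    Real.sq_sqrt (mul_nonneg (by linarith [hp.2]) (by linarith [hp.1]))
  rw [lamPF]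
  linear_combination h / 4

lemma lamR_sq (hp : p ∈ Ioo (0 : ℝ) 1) : lamR p ^ 2 = (1 - p) * lamR p + p * (1 - p) := by
  have h : √((1 - p) * (3 * p + 1)) ^ 2 = (1 - p) * (3 * p + 1) :=
    Real.sq_sqrt (mul_nonneg (by linarith [hp.2]) (by linarith [hp.1]))
  rw [lamR]
  linear_combination h / 4

/-- The transfer recursion, diagonalised. -/
lemma noPairWeight_eq (hp : p ∈ Ioo (0 : ℝ) 1) : ∀ n,
    (lamPF p - lamR p) * noPairWeight p n =
      (1 - lamR p) * lamPF p ^ n - (1 - lamPF p) * lamR p ^ n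
  | 0 => by simp [noPairWeight]
  | 1 => by simp only [noPairWeight]; ring
  | n + 2 => by
    have h1 := noPairWeight_eq hp (n + 1)
    have h0 := noPairWeight_eq hp n
    rw [noPairWeight]
    linear_combination (1 - p) * h1 + p * (1 - p) * h0 -
      (1 - lamR p) * lamPF p ^ n * lamPF_sq hp + (1 - lamPF p) * lamR p ^ n * lamR_sq hp

lemma gFun_zero : gFun p 0 = 0 := rfl

lemma gFun_one : gFun p ((1 : ℕ) : ℕ∞) = 1 - p := rfl

lemma gFun_top (hp : p ∈ Ioo (0 : ℝ) 1) : gFun p ⊤ = lamPF p := by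
  have : 1 - lamPF p ≠ 0 := (sub_pos.2 (lamPF_lt_one hp)).ne'
  change (lamPF p / (1 - lamPF p)) / (1 / (1 - lamPF p)) = _
  field_simp

lemma gFun_add_two (hp : p ∈ Ioo (0 : ℝ) 1) (n : ℕ) :
    gFun p ((n + 2 : ℕ) : ℕ∞) = noPairWeight p (n + 2) / noPairWeight p (n + 1) := by
  have hF := lamPF_pos hp
  have hF1 : 0 < 1 - lamPF p := sub_pos.2 (lamPF_lt_one hp)
  have hR := lamR_neg hp
  have hR1 : 0 < 1 - lamR p := by linarith
  have habs : |ratio p| = -ratio p := abs_of_neg (div_neg_of_neg_of_pos hR hF)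
  -- The ratio is negative, so the alternating signs in `gFun` merely turn powers of its absolute
  -- value into powers of the ratio itself.
  have hsgn : ∀ k, (-1 : ℝ) ^ k * |ratio p| ^ k = ratio p ^ k := fun k => by
    rw [habs, ← mul_pow]; ring
  have hd : 0 < lamPF p - lamR p := by linarith
  have hden := noPairWeight_eq hp (n + 1)
  have hnum := noPairWeight_eq hp (n + 2)
  have e : ∀ k, ratio p ^ k * lamPF p ^ k = lamR p ^ k := fun k => by
    rw [← mul_pow, ratio, div_mul_cancel₀ _ hF.ne']
  have key : gFun p ((n + 2 : ℕ) : ℕ∞) =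
      (-(ratio p ^ (n + 2)) * (lamPF p / (1 - lamR p)) + lamPF p / (1 - lamPF p)) /
      (-(ratio p ^ (n + 1)) * (1 / (1 - lamR p)) + 1 / (1 - lamPF p)) := by
    rw [← hsgn, ← hsgn]
    change ((-1) ^ (n + 3) * |ratio p| ^ (n + 2) * (lamPF p / (1 - lamR p)) +
        lamPF p / (1 - lamPF p)) /
      ((-1) ^ (n + 2) * |ratio p| ^ (n + 1) * (1 / (1 - lamR p)) + 1 / (1 - lamPF p)) = _
    congr 1 <;> ring
  have h1 : -(ratio p ^ (n + 2)) * (lamPF p / (1 - lamR p)) + lamPF p / (1 - lamPF p) =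
      (lamPF p - lamR p) * noPairWeight p (n + 2) /
        ((1 - lamR p) * (1 - lamPF p) * lamPF p ^ (n + 1)) := by
    rw [hnum, ← e]
    field_simp
    ring
  have h2 : -(ratio p ^ (n + 1)) * (1 / (1 - lamR p)) + 1 / (1 - lamPF p) =
      (lamPF p - lamR p) * noPairWeight p (n + 1) /
        ((1 - lamR p) * (1 - lamPF p) * lamPF p ^ (n + 1)) := by
    rw [hden, ← e]
    field_simp
    ring
  have := noPairWeight_pos hp (n + 1)
  rw [key, h1, h2]
  field_simp

/-- The link between the analytic formula and probability: `g_p(n + 1)` is the conditional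
probability that a gap of length `n` continues. -/
lemma gFun_mul_gapWeight (hp : p ∈ Ioo (0 : ℝ) 1) : ∀ n : ℕ,
    gFun p ((n + 1 : ℕ) : ℕ∞) * gapWeight p n = gapWeight p (n + 1)
  | 0 => by
    rw [zero_add, gFun_one]
    simp [gapWeight, noPairWeight]
  | n + 1 => by
    have := noPairWeight_pos hp (n + 1)
    rw [gFun_add_two hp]
    simp only [gapWeight]
    field_simp

lemma gFun_mem_Icc (hp : p ∈ Ioo (0 : ℝ) 1) (n : ℕ∞) : gFun p n ∈ Icc (0 : ℝ) 1 := by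
  induction n using ENat.recTopCoe with
  | top => rw [gFun_top hp]; exact ⟨(lamPF_pos hp).le, (lamPF_lt_one hp).le⟩
  | coe n =>
    cases n with
    | zero => exact ⟨le_rfl, zero_le_one⟩
    | succ n =>
      have h := gapWeight_pos hp n
      rw [eq_div_of_mul_eq h.ne' (gFun_mul_gapWeight hp n)]
      exact ⟨div_nonneg (gapWeight_pos hp _).le h.le,
        (div_le_one h).2 (gapWeight_anti hp n)⟩

/-- The conditional probability of a one is bounded below. -/
lemma exists_le_one_sub_gFun (hp : p ∈ Ioo (0 : ℝ) 1) :
    ∃ ε > 0, ∀ n : ℕ∞, ε ≤ 1 - gFun p n := by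
  have h0 := hp.1
  have h1 : 0 < 1 - p := sub_pos.2 hp.2
  have hle : p ^ 2 * (1 - p) ≤ p := by
    have : p ^ 2 ≤ p := by nlinarith
    nlinarith
  -- The second entry serves distance `∞`. For distance `n + 3`, `noPairWeight_sub` gives `p ^ 2 *
  -- (1 - p)` times a quotient that is at least `1` by monotonicity; distances up to `2` are checked
  -- directly.
  refine ⟨min (p ^ 2 * (1 - p)) (1 - lamPF p),
    lt_min (by positivity) (sub_pos.2 (lamPF_lt_one hp)), ?_⟩
  intro n
  induction n using ENat.recTopCoe with
  | top => rw [gFun_top hp]; exact min_le_right _ _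
  | coe n =>
    refine (min_le_left _ _).trans ?_
    match n with
    | 0 => rw [Nat.cast_zero, gFun_zero]; linarith
    | 1 => rw [gFun_one]; linarith
    | 2 =>
      rw [gFun_add_two hp 0]
      simp only [noPairWeight]
      nlinarith
    | n + 3 =>
      have hn2 := noPairWeight_pos hp (n + 2)
      rw [gFun_add_two hp (n + 1), one_sub_div hn2.ne', le_div_iff₀ hn2, noPairWeight_sub]
      have : noPairWeight p (n + 2) ≤ noPairWeight p n :=
        (noPairWeight_anti hp _).trans (noPairWeight_anti hp _)
      gcongr

lemma spinProb_nonneg (hp : p ∈ Ioo (0 : ℝ) 1) (n : ℕ∞) (b : Bool) : 0 ≤ spinProb p n b := by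
  have := gFun_mem_Icc hp n
  cases b
  · exact this.1
  · exact sub_nonneg.2 this.2

end Algebra

/-! ### Configurations without isolated ones -/

lemma thin_eq_self_iff {ω : Config} :
    thin ω = ω ↔ ∀ i, ω i = true → ω (i - 1) = true ∨ ω (i + 1) = true := by
  simp only [thin, funext_iff, Bool.and_eq_left_iff_imp, Bool.or_eq_true]

lemma thin_thin (ω : Config) : thin (thin ω) = thin ω := by
  rw [thin_eq_self_iff]
  intro i hi
  simp only [thin, Bool.and_eq_true, Bool.or_eq_true, sub_add_cancel, add_sub_cancel_right] at hi ⊢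
  obtain ⟨h, h' | h'⟩ := hi <;> simp [h, h']

lemma thin_coe (ω : Config') : thin ω.1 = ω.1 := by
  obtain ⟨_, η, rfl⟩ := ω
  exact thin_thin η

lemma eq_true_or_of_eq_true (ω : Config') {i : ℤ} (h : ω.1 i = true) :
    ω.1 (i - 1) = true ∨ ω.1 (i + 1) = true :=
  thin_eq_self_iff.1 (thin_coe ω) i h

lemma thin'_apply (ω : Config) (i : ℤ) : (thin' ω).1 i = (ω i && (ω (i - 1) || ω (i + 1))) := rfl

/-! ### The distance to the nearest pair of ones -/

lemma pairDist_congr {ω η : Config} {i : ℤ} (h : ∀ j < i, ω j = η j) :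
    pairDist ω i = pairDist η i := by
  have e : {k : ℕ | 1 ≤ k ∧ ω (i - k - 1) = true ∧ ω (i - k) = true} =
      {k : ℕ | 1 ≤ k ∧ η (i - k - 1) = true ∧ η (i - k) = true} := by
    ext k
    simp only [mem_ofPred_eq]
    refine and_congr_right fun hk => ?_
    rw [h _ (by omega), h _ (by omega)]
  rw [pairDist, pairDist, e, h _ (by omega), h _ (by omega)]

lemma pairDist_eq_zero_iff {ω : Config} {i : ℤ} :
    pairDist ω i = 0 ↔ ω (i - 2) = false ∧ ω (i - 1) = true := by
  rw [pairDist]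
  split_ifs with h
  · exact iff_of_true rfl h
  · refine iff_of_false (fun h0 => ?_) h
    have : (1 : ℕ∞) ≤ ⨅ k ∈ {k : ℕ | 1 ≤ k ∧ ω (i - k - 1) = true ∧ ω (i - k) = true}, (k : ℕ∞) :=
      le_iInf₂ fun k hk => by exact_mod_cast hk.1
    rw [h0] at this
    simp at this

lemma pairDist_of_pair_of_agree_le {ω η : Config} {s i : ℤ} (hsi : s + 1 < i)
    (h : ∀ j, s ≤ j → j < i → ω j = η j) (h0 : ω s = true) (h1 : ω (s + 1) = true) :
    pairDist ω i ≤ pairDist η i := by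
  rw [pairDist, pairDist, h (i - 2) (by omega) (by omega), h (i - 1) (by omega) (by omega)]
  split_ifs
  · exact le_rfl
  · refine le_iInf₂ fun k hk => ?_
    by_cases hks : s ≤ i - k - 1
    · exact iInf₂_le k ⟨hk.1, (h _ hks (by omega)).trans hk.2.1,
        (h _ (by omega) (by have := hk.1; omega)).trans hk.2.2⟩
    · refine (iInf₂_le (i - s - 1).toNat ⟨by omega, ?_, ?_⟩).trans
        (by exact_mod_cast (by omega : (i - s - 1).toNat ≤ k))
      · rwa [show i - ((i - s - 1).toNat : ℤ) - 1 = s by omega]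
      · rwa [show i - ((i - s - 1).toNat : ℤ) = s + 1 by omega]

/-- The distance only depends on the spins to the right of any pair of ones in the past. -/
lemma pairDist_of_pair_of_agree {ω η : Config} {s i : ℤ} (hsi : s + 1 < i)
    (h : ∀ j, s ≤ j → j < i → ω j = η j) (h0 : ω s = true) (h1 : ω (s + 1) = true) :
    pairDist ω i = pairDist η i :=
  (pairDist_of_pair_of_agree_le hsi h h0 h1).antisymm
    (pairDist_of_pair_of_agree_le hsi (fun j hj hj' => (h j hj hj').symm)
      ((h s le_rfl (by omega)).symm.trans h0) ((h _ (by omega) hsi).symm.trans h1))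

/-- Absence of isolated ones is essential: a one between the last pair and `i` would have an
occupied neighbour and form a closer pair. The only exception is a one at `i - 1` whose partner is
`i`, which is distance `0`. -/
lemma pairDist_eq_succ_iff (ω : Config') (i : ℤ) (n : ℕ) :
    pairDist ω.1 i = ((n + 1 : ℕ) : ℕ∞) ↔
      ω.1 (i - n - 2) = true ∧ ω.1 (i - n - 1) = true ∧
        ∀ j, i - n - 1 < j → j < i → ω.1 j = false := by
  constructor
  · intro h
    have hne : ¬(ω.1 (i - 2) = false ∧ ω.1 (i - 1) = true) := by
      rw [← pairDist_eq_zero_iff, h]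
      simp
    rw [pairDist, if_neg hne] at h
    have hle : ∀ k : ℕ, 1 ≤ k → ω.1 (i - k - 1) = true → ω.1 (i - k) = true → n + 1 ≤ k := by
      intro k hk h1 h2
      have := h.symm.le.trans (iInf₂_le k ⟨hk, h1, h2⟩)
      exact_mod_cast this
    have hmem : ω.1 (i - (n + 1 : ℕ) - 1) = true ∧ ω.1 (i - (n + 1 : ℕ)) = true := by
      by_contra hcon
      have : ((n + 2 : ℕ) : ℕ∞) ≤ ((n + 1 : ℕ) : ℕ∞) := by
        rw [← h]
        refine le_iInf₂ fun k hk => ?_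
        have h1 := hle k hk.1 hk.2.1 hk.2.2
        have h2 : k ≠ n + 1 := fun hkn => hcon (hkn ▸ hk.2)
        exact_mod_cast (by omega : n + 2 ≤ k)
      have : n + 2 ≤ n + 1 := by exact_mod_cast this
      omega
    push_cast at hmem
    refine ⟨by convert hmem.1 using 2; ring, by convert hmem.2 using 2; ring, fun j hj hji => ?_⟩
    by_contra hω
    rw [Bool.not_eq_false] at hω
    rcases eq_true_or_of_eq_true ω hω with h' | h'
    · have := hle (i - j).toNat (by omega)
        (by rwa [show i - ((i - j).toNat : ℤ) - 1 = j - 1 by omega])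
        (by rwa [show i - ((i - j).toNat : ℤ) = j by omega])
      omega
    · rcases eq_or_ne (j + 1) i with hj1 | hj1
      · obtain rfl : j = i - 1 := by omega
        have h2 : ω.1 (i - 2) = true := by
          by_contra hcon
          exact hne ⟨by simpa using hcon, hω⟩
        have := hle 1 le_rfl (by convert h2 using 2; push_cast; ring) (by simpa using hω)
        omega
      · have := hle (i - j - 1).toNat (by omega)
          (by rwa [show i - ((i - j - 1).toNat : ℤ) - 1 = j by omega])
          (by rwa [show i - ((i - j - 1).toNat : ℤ) = j + 1 by omega])
        omega
  · rintro ⟨h1, h2, h3⟩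
    have hne : ¬(ω.1 (i - 2) = false ∧ ω.1 (i - 1) = true) := by
      rintro ⟨ha, hb⟩
      rcases Nat.eq_zero_or_pos n with rfl | hn
      · simp [ha] at h1
      · rw [h3 (i - 1) (by omega) (by omega)] at hb
        exact absurd hb (by simp)
    rw [pairDist, if_neg hne]
    apply le_antisymm
    · refine iInf₂_le (n + 1) ⟨by omega, ?_, ?_⟩
      · convert h1 using 2; push_cast; ring
      · convert h2 using 2; push_cast; ring
    · refine le_iInf₂ fun k hk => ?_
      by_contra hlt
      have hlt : k < n + 1 := by exact_mod_cast not_le.1 hlt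
      have := h3 (i - k) (by omega) (by have := hk.1; omega)
      rw [hk.2.2] at this
      exact absurd this (by simp)

/-! ### Functions of the spins in a given region -/

/-- `f` only depends on the spins at the sites in `Δ`. -/
def SpinDependsOn {α : Type*} (f : Config' → α) (Δ : Set ℤ) : Prop :=
  ∀ ⦃ω η : Config'⦄, (∀ j ∈ Δ, ω.1 j = η.1 j) → f ω = f η

lemma SpinDependsOn.mono {α : Type*} {f : Config' → α} {Δ Δ' : Set ℤ} (hf : SpinDependsOn f Δ)
    (h : Δ ⊆ Δ') : SpinDependsOn f Δ' :=
  fun _ _ hωη => hf fun j hj => hωη j (h hj)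

lemma sigmaOn_eq (Δ : Set ℤ) :
    sigmaOn Δ = MeasurableSpace.comap (fun (ω : Config') (j : Δ) => ω.1 j) inferInstance := by
  simp only [sigmaOn, cylinderEvents, MeasurableSpace.pi, MeasurableSpace.comap_iSup,
    MeasurableSpace.comap_comp, iSup_subtype]
  rfl

lemma sigmaOn_mono {Δ Δ' : Set ℤ} (h : Δ ⊆ Δ') : sigmaOn Δ ≤ sigmaOn Δ' :=
  MeasurableSpace.comap_mono (cylinderEvents_mono h)

lemma sigmaOn_le (Δ : Set ℤ) : sigmaOn Δ ≤ (inferInstance : MeasurableSpace Config') :=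
  MeasurableSpace.comap_mono cylinderEvents_le_pi

lemma sigmaLE_eq_sigmaLT (m : ℤ) : sigmaLE m = sigmaLT (m + 1) := by
  have : Iic m = Iio (m + 1) := by ext; simp
  rw [sigmaLE, sigmaLT, this]

/-- Level sets of `f` are preimages under restriction to `Δ`. This turns measurability into a
pointwise statement, the form used in all kernel computations. -/
lemma spinDependsOn_of_measurable {Δ : Set ℤ} {f : Config' → ℝ≥0∞}
    (hf : Measurable[sigmaOn Δ] f) : SpinDependsOn f Δ := by
  intro ω η h
  have hs : MeasurableSet[sigmaOn Δ] (f ⁻¹' {f η}) := hf (measurableSet_singleton _)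
  rw [sigmaOn_eq] at hs
  obtain ⟨t, -, ht⟩ := hs
  have hη : η ∈ f ⁻¹' {f η} := rfl
  rw [← ht, mem_preimage] at hη
  have : ω ∈ f ⁻¹' {f η} := by
    rw [← ht, mem_preimage]
    convert hη using 1
    exact funext fun j => h j j.2
  exact this

lemma measurable_sigmaOn_apply {Δ : Set ℤ} {j : ℤ} (hj : j ∈ Δ) :
    Measurable[sigmaOn Δ] fun ω : Config' => ω.1 j :=
  (measurable_cylinderEvent_apply (X := fun _ : ℤ => Bool) hj).comp (comap_measurable _)

lemma measurableSet_sigmaOn_apply_eq {Δ : Set ℤ} {j : ℤ} (hj : j ∈ Δ) (b : Bool) :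
    MeasurableSet[sigmaOn Δ] {ω : Config' | ω.1 j = b} :=
  measurable_sigmaOn_apply hj (measurableSet_singleton b)

lemma measurable_sigmaOn_iff {α : Type*} {mα : MeasurableSpace α} {Δ : Set ℤ} {g : α → Config'} :
    @Measurable _ _ mα (sigmaOn Δ) g ↔ ∀ j ∈ Δ, Measurable fun a => (g a).1 j := by
  rw [measurable_comap_iff, measurable_cylinderEvents_iff]
  rfl

lemma measurable_pairDist (i : ℤ) :
    Measurable[sigmaLT i] fun ω : Config' => pairDist ω.1 i := by
  let _ : MeasurableSpace Config' := sigmaLT i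
  refine ENat.measurable_iff.2 fun n => ?_
  cases n with
  | zero =>
    have : (fun ω : Config' => pairDist ω.1 i) ⁻¹' {((0 : ℕ) : ℕ∞)} =
        {ω | ω.1 (i - 2) = false} ∩ {ω | ω.1 (i - 1) = true} := by
      ext ω
      exact pairDist_eq_zero_iff
    rw [this]
    exact (measurableSet_sigmaOn_apply_eq (by simp) _).inter
      (measurableSet_sigmaOn_apply_eq (by simp) _)
  | succ n =>
    have : (fun ω : Config' => pairDist ω.1 i) ⁻¹' {((n + 1 : ℕ) : ℕ∞)} =
        {ω | ω.1 (i - n - 2) = true} ∩ ({ω | ω.1 (i - n - 1) = true} ∩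
          ⋂ j ∈ Ioo (i - n - 1) i, {ω | ω.1 j = false}) := by
      ext ω
      simp only [mem_preimage, mem_singleton_iff, pairDist_eq_succ_iff, mem_inter_iff, mem_ofPred_eq,
        mem_iInter, mem_Ioo, and_imp]
    rw [this]
    refine (measurableSet_sigmaOn_apply_eq ?_ _).inter
      ((measurableSet_sigmaOn_apply_eq ?_ _).inter
        (MeasurableSet.biInter (to_countable _) fun j hj =>
          measurableSet_sigmaOn_apply_eq (j := j) hj.2 _))
    · simp only [mem_Iio]; omega
    · simp only [mem_Iio]; omega

/-! ### Sampling one spin after the other -/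

/-- Keep `ω` to the left of `i`, put `b` at `i`, and ones to the right of `i`. -/
def put (i : ℤ) (ω : Config) (b : Bool) : Config := fun j =>
  if j < i then ω j else if j = i then b else true

/-- The element of `Ω'` which extends the spins of `ω` to the left of `i` by the spin `b` at `i`. -/
def extend (i : ℤ) (ω : Config') (b : Bool) : Config' := thin' (put i ω.1 b)

/-- The conditional probability of the spin `b` at `i` given the past `ω`. -/
def weight (p : ℝ) (i : ℤ) (ω : Config') (b : Bool) : ℝ≥0∞ :=
  ENNReal.ofReal (spinProb p (pairDist ω.1 i) b)

/-- Integrate out the spin at `i`. -/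
def step (p : ℝ) (i : ℤ) (f : Config' → ℝ≥0∞) (ω : Config') : ℝ≥0∞ :=
  ∑ b, weight p i ω b * f (extend i ω b)

/-- Integrate out the spins at `l, …, l + k - 1`. -/
def steps (p : ℝ) (l : ℤ) : ℕ → (Config' → ℝ≥0∞) → Config' → ℝ≥0∞
  | 0, f => f
  | k + 1, f => steps p l k (step p (l + k) f)

lemma extend_apply_self (i : ℤ) (ω : Config') (b : Bool) : (extend i ω b).1 i = b := by
  simp [extend, thin'_apply, put]

lemma extend_apply_of_lt_pred {i j : ℤ} (ω : Config') (b : Bool) (h : j < i - 1) :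
    (extend i ω b).1 j = ω.1 j := by
  rw [extend, thin'_apply, put, if_pos (by omega), put, if_pos (by omega), put, if_pos (by omega)]
  exact congrFun (thin_coe ω) j

/-- The spin at `i - 1` can be erased only if it is a one with both `i - 2` and `i` empty, that is,
at distance `0` with `b = 0`. The hypothesis excludes exactly this case, which has weight zero. -/
lemma extend_apply_pred {i : ℤ} {ω : Config'} {b : Bool}
    (h : pairDist ω.1 i = 0 → b = true) : (extend i ω b).1 (i - 1) = ω.1 (i - 1) := by
  rw [pairDist_eq_zero_iff] at h
  simp only [extend, thin'_apply, put, sub_add_cancel, lt_irrefl, if_false, if_true,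
    sub_one_lt, show i - 1 - 1 = i - 2 by ring]
  revert h
  cases ω.1 (i - 1) <;> cases ω.1 (i - 2) <;> simp

lemma extend_apply_of_lt {i j : ℤ} {ω : Config'} {b : Bool}
    (h : pairDist ω.1 i = 0 → b = true) (hj : j < i) : (extend i ω b).1 j = ω.1 j := by
  rcases eq_or_ne j (i - 1) with rfl | hne
  · exact extend_apply_pred h
  · exact extend_apply_of_lt_pred ω b (by omega)

lemma eq_true_of_weight_ne_zero {p : ℝ} {i : ℤ} {ω : Config'} {b : Bool}
    (h : weight p i ω b ≠ 0) : pairDist ω.1 i = 0 → b = true := by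
  intro h0
  by_contra hb
  rw [Bool.not_eq_true] at hb
  apply h
  simp [weight, h0, hb, spinProb, gFun_zero]

/-- The inequality `s < j` is strict because thinning at `j` looks at `j - 1`. -/
lemma extend_congr {i s : ℤ} {ω η : Config'} (b : Bool) (h : ∀ j, s ≤ j → j < i → ω.1 j = η.1 j)
    {j : ℤ} (hsj : s < j) : (extend i ω b).1 j = (extend i η b).1 j := by
  have e : ∀ k, s ≤ k → put i ω.1 b k = put i η.1 b k := fun k hk => by
    simp only [put]
    split_ifs with h'
    · exact h k hk h'
    · rfl
    · rfl
  simp only [extend, thin'_apply]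
  rw [e j (by omega), e (j - 1) (by omega), e (j + 1) (by omega)]

section Weights

variable {p : ℝ} (hp : p ∈ Ioo (0 : ℝ) 1)
include hp

lemma sum_weight (i : ℤ) (ω : Config') : ∑ b, weight p i ω b = 1 := by
  simp only [weight]
  rw [← ENNReal.ofReal_sum_of_nonneg fun b _ => spinProb_nonneg hp _ b]
  simp [spinProb]

/-- Extensions of positive weight leave the past intact and the weights sum to one. This yields
properness of the kernels and half of their consistency. -/
lemma step_of_spinDependsOn {i : ℤ} {f : Config' → ℝ≥0∞} (hf : SpinDependsOn f (Iio i)) :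
    step p i f = f := by
  funext ω
  have : ∀ b, weight p i ω b * f (extend i ω b) = weight p i ω b * f ω := by
    intro b
    by_cases hb : weight p i ω b = 0
    · simp [hb]
    · rw [hf fun j hj => extend_apply_of_lt (eq_true_of_weight_ne_zero hb) hj]
  rw [step, Finset.sum_congr rfl fun b _ => this b, ← Finset.sum_mul, sum_weight hp, one_mul]

lemma steps_of_spinDependsOn {l : ℤ} {f : Config' → ℝ≥0∞} (hf : SpinDependsOn f (Iio l)) (k : ℕ) :
    steps p l k f = f := by
  induction k with
  | zero => rfl
  | succ k ih =>
    rw [steps, step_of_spinDependsOn hp, ih]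
    exact hf.mono (Iio_subset_Iio (by omega))

end Weights

lemma steps_add (p : ℝ) (l : ℤ) (a b : ℕ) (f : Config' → ℝ≥0∞) :
    steps p l (a + b) f = steps p l a (steps p (l + a) b f) := by
  induction b generalizing f with
  | zero => rfl
  | succ b ih =>
    rw [← add_assoc, steps, ih, steps]
    push_cast
    rw [add_assoc]

lemma SpinDependsOn.step {p : ℝ} {i : ℤ} {f : Config' → ℝ≥0∞}
    (hf : SpinDependsOn f (Iio (i + 1))) : SpinDependsOn (step p i f) (Iio i) := by
  intro ω η h
  simp only [TBF.step, weight]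
  rw [pairDist_congr h]
  refine Finset.sum_congr rfl fun b _ => ?_
  congr 1
  apply hf
  intro j _
  exact extend_congr (s := j - 1) b (fun k _ hk' => h k hk') (by omega)

lemma measurable_extend (i : ℤ) (b : Bool) :
    @Measurable _ _ (sigmaLT i) (sigmaLT (i + 1)) fun ω => extend i ω b := by
  let _ : MeasurableSpace Config' := sigmaLT i
  rw [measurable_sigmaOn_iff]
  have e : ∀ k, Measurable fun ω : Config' => put i ω.1 b k := by
    intro k
    simp only [put]
    split_ifs with h
    · exact measurable_sigmaOn_apply h
    · exact measurable_const
    · exact measurable_const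
  intro j _
  have h3 : Measurable fun x : Bool × Bool × Bool => (x.1 && (x.2.1 || x.2.2)) :=
    measurable_of_countable _
  exact h3.comp ((e j).prodMk ((e (j - 1)).prodMk (e (j + 1))))

lemma measurable_step (p : ℝ) {i : ℤ} {f : Config' → ℝ≥0∞} (hf : Measurable[sigmaLT (i + 1)] f) :
    Measurable[sigmaLT i] (step p i f) := by
  let _ : MeasurableSpace Config' := sigmaLT i
  refine Finset.measurable_fun_sum _ fun b _ => Measurable.mul ?_ (hf.comp (measurable_extend i b))
  exact (measurable_of_countable fun n : ℕ∞ => ENNReal.ofReal (spinProb p n b)).comp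
    (measurable_pairDist i)

lemma measurable_steps (p : ℝ) {l : ℤ} (k : ℕ) {f : Config' → ℝ≥0∞}
    (hf : Measurable[sigmaLT (l + k)] f) : Measurable[sigmaLT l] (steps p l k f) := by
  induction k generalizing f with
  | zero => rwa [Nat.cast_zero, add_zero] at hf
  | succ k ih =>
    refine ih (measurable_step p ?_)
    convert hf using 2
    push_cast
    ring

/-! ### The kernels of `lis` in terms of `steps` -/

/-- Spins on `[l, m + 1]` are spins on `[l, m]` together with a spin at `m + 1`. -/
def spinsSuccEquiv (l m : ℤ) (h : l ≤ m + 1) :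
    (Finset.Icc l (m + 1) → Bool) ≃ (Finset.Icc l m → Bool) × Bool where
  toFun x := (fun i => x ⟨i, Finset.mem_Icc.2 (by have := Finset.mem_Icc.1 i.2; omega)⟩,
    x ⟨m + 1, Finset.mem_Icc.2 ⟨h, le_rfl⟩⟩)
  invFun y i := if hi : i.1 ∈ Finset.Icc l m then y.1 ⟨i, hi⟩ else y.2
  left_inv x := by
    funext i
    dsimp only
    split_ifs with hi
    · rfl
    · congr 1
      have h1 := Finset.mem_Icc.1 i.2
      rw [Finset.mem_Icc] at hi
      exact Subtype.ext (by dsimp only; omega)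
  right_inv y := by
    refine Prod.ext (funext fun i => ?_) ?_
    · simp only [i.2, dite_true]
    · simp

lemma splice_spinsSuccEquiv_symm (l m : ℤ) (h : l ≤ m + 1) (ω : Config)
    (y : Finset.Icc l m → Bool) (b : Bool) :
    splice l (m + 1) ω ((spinsSuccEquiv l m h).symm (y, b)) = put (m + 1) (splice l m ω y) b := by
  funext j
  simp only [splice, put, spinsSuccEquiv, Equiv.coe_fn_symm_mk, Finset.mem_Icc]
  split_ifs <;> first | rfl | (exfalso; omega)

/-- The probability of the spins of `σ` in `[l, m]` given the spins to the left of `l`. -/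
def blockWeight (p : ℝ) (l m : ℤ) (σ : Config) : ℝ :=
  ∏ i ∈ Finset.Icc l m, spinProb p (pairDist σ i) (σ i)

lemma prod_splice (p : ℝ) (l m : ℤ) (ω : Config) (x : Finset.Icc l m → Bool) :
    ∏ i : Finset.Icc l m, spinProb p (pairDist (splice l m ω x) i) (x i) =
      blockWeight p l m (splice l m ω x) := by
  rw [blockWeight, ← Finset.prod_coe_sort (Finset.Icc l m)
    fun i => spinProb p (pairDist (splice l m ω x) i) (splice l m ω x i)]
  refine Finset.prod_congr rfl fun i _ => ?_
  congr 1
  simp only [splice, i.2, dite_true]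

lemma blockWeight_put (p : ℝ) {l m : ℤ} (h : l ≤ m + 1) (σ : Config) (b : Bool) :
    blockWeight p l (m + 1) (put (m + 1) σ b) =
      blockWeight p l m σ * spinProb p (pairDist σ (m + 1)) b := by
  have hlt : ∀ j < m + 1, put (m + 1) σ b j = σ j := fun j hj => by rw [put, if_pos hj]
  have hins : Finset.Icc l (m + 1) = insert (m + 1) (Finset.Icc l m) := by
    ext j
    simp only [Finset.mem_Icc, Finset.mem_insert]
    omega
  rw [blockWeight, hins, Finset.prod_insert (by simp), mul_comm, blockWeight]
  congr 1
  · refine Finset.prod_congr rfl fun i hi => ?_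
    have := (Finset.mem_Icc.1 hi).2
    rw [hlt i (by omega), pairDist_congr fun j hj => hlt j (by omega)]
  · rw [pairDist_congr hlt, put, if_neg (lt_irrefl _), if_pos rfl]

lemma blockWeight_nonneg {p : ℝ} (hp : p ∈ Ioo (0 : ℝ) 1) (l m : ℤ) (σ : Config) :
    0 ≤ blockWeight p l m σ :=
  Finset.prod_nonneg fun _ _ => spinProb_nonneg hp _ _

lemma splice_of_lt {l m j : ℤ} (ω : Config) (x : Finset.Icc l m → Bool) (h : j < l) :
    splice l m ω x j = ω j := by
  rw [splice, dif_neg (fun h' => by have := (Finset.mem_Icc.1 h').1; omega), if_pos h]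

lemma splice_of_gt {l m j : ℤ} (ω : Config) (x : Finset.Icc l m → Bool) (h : m < j) (hl : l ≤ j) :
    splice l m ω x j = true := by
  rw [splice, dif_neg (fun h' => by have := (Finset.mem_Icc.1 h').2; omega), if_neg (by omega)]

/-- Spins of positive weight create no isolated ones. -/
lemma thin_splice {p : ℝ} {l m : ℤ} (hlm : l ≤ m + 1) (ω : Config') (x : Finset.Icc l m → Bool)
    (h : blockWeight p l m (splice l m ω.1 x) ≠ 0) :
    thin (splice l m ω.1 x) = splice l m ω.1 x := by
  rw [thin_eq_self_iff]
  intro j hj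
  rcases le_or_gt m j with hmj | hmj
  · exact Or.inr (splice_of_gt _ _ (by omega) (by omega))
  rcases le_or_gt l (j + 1) with hl | hl
  · by_contra hcon
    rw [not_or, Bool.not_eq_true, Bool.not_eq_true] at hcon
    -- An isolated one at `j` makes the factor at `j + 1` equal to `g_p(0) = 0`.
    refine h (Finset.prod_eq_zero (Finset.mem_Icc.2 ⟨hl, by omega⟩) ?_)
    have h0 : pairDist (splice l m ω.1 x) (j + 1) = 0 := by
      rw [pairDist_eq_zero_iff, show j + 1 - 2 = j - 1 by ring, add_sub_cancel_right]
      exact ⟨hcon.1, hj⟩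
    rw [h0, hcon.2]
    rfl
  · rw [splice_of_lt _ _ (by omega)] at hj
    rw [splice_of_lt _ _ (by omega), splice_of_lt _ _ hl]
    exact eq_true_or_of_eq_true ω hj

/-- Induction on the length, splitting off the rightmost spin: the weight factorises, and when the
remaining weight is positive, `thin'` fixes the spliced configuration, so putting one more spin is
`extend`. -/
lemma sum_blockWeight_eq_steps {p : ℝ} (hp : p ∈ Ioo (0 : ℝ) 1) (l : ℤ) (k : ℕ) (m : ℤ)
    (hm : m + 1 = l + k) {f : Config' → ℝ≥0∞} (hf : SpinDependsOn f (Iio (l + k))) (ω : Config') :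
    ∑ x : Finset.Icc l m → Bool, ENNReal.ofReal (blockWeight p l m (splice l m ω.1 x)) *
      f (thin' (splice l m ω.1 x)) = steps p l k f ω := by
  induction k generalizing f m with
  | zero =>
    obtain rfl : m = l - 1 := by push_cast at hm; omega
    have : IsEmpty (Finset.Icc l (l - 1)) :=
      ⟨fun i => by have := Finset.mem_Icc.1 i.2; omega⟩
    have hW : ∀ σ, blockWeight p l (l - 1) σ = 1 := fun σ => by
      rw [blockWeight, Finset.Icc_eq_empty (by omega), Finset.prod_empty]
    suffices key : ∀ x, f (thin' (splice l (l - 1) ω.1 x)) = f ω by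
      rw [Fintype.sum_unique, hW, ENNReal.ofReal_one, one_mul, key, steps]
    intro x
    apply hf
    intro j hj
    rw [Nat.cast_zero, add_zero, mem_Iio] at hj
    set σ := splice l (l - 1) ω.1 x
    have h1 : σ j = ω.1 j := splice_of_lt _ _ hj
    have h2 : σ (j - 1) = ω.1 (j - 1) := splice_of_lt _ _ (by omega)
    rw [thin'_apply, h1, h2]
    rcases eq_or_ne (j + 1) l with h | h
    -- At `j = l - 1` the right neighbour is an artificial one, so the spin at `j` survives
    -- unchanged.
    · have h3 : σ (j + 1) = true := splice_of_gt _ _ (by omega) (by omega)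
      rw [h3, Bool.or_true, Bool.and_true]
    · have h3 : σ (j + 1) = ω.1 (j + 1) := splice_of_lt _ _ (by omega)
      rw [h3]
      exact congrFun (thin_coe ω) j
  | succ k ih =>
    push_cast at hm hf
    obtain ⟨m, rfl⟩ : ∃ m', m = m' + 1 := ⟨m - 1, by ring⟩
    have hlm : l ≤ m + 1 := by omega
    obtain hm' : l + k = m + 1 := by omega
    rw [steps, ← ih m (by omega) (SpinDependsOn.step (by rwa [add_assoc])),
      ← (spinsSuccEquiv l m hlm).symm.sum_comp, Fintype.sum_prod_type]
    refine Finset.sum_congr rfl fun y _ => ?_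
    simp only [splice_spinsSuccEquiv_symm, blockWeight_put p hlm]
    by_cases hW : blockWeight p l m (splice l m ω.1 y) = 0
    · simp [hW]
    have ht : (thin' (splice l m ω.1 y)).1 = splice l m ω.1 y := thin_splice hlm ω y hW
    rw [step, Finset.mul_sum]
    refine Finset.sum_congr rfl fun b _ => ?_
    rw [weight, extend, hm', ht, ENNReal.ofReal_mul (blockWeight_nonneg hp _ _ _), mul_assoc]

lemma measurable_indicator_one {Ω : Type*} {mΩ : MeasurableSpace Ω} {A : Set Ω}
    (hA : MeasurableSet A) : Measurable (A.indicator (1 : Ω → ℝ≥0∞)) :=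
  measurable_one.indicator hA

lemma measurable_steps_toNat (p : ℝ) {l m : ℤ} (hlm : l ≤ m) {f : Config' → ℝ≥0∞}
    (hf : Measurable[sigmaLE m] f) : Measurable[sigmaLT l] (steps p l (m + 1 - l).toNat f) := by
  refine measurable_steps p _ ?_
  rwa [show l + ((m + 1 - l).toNat : ℤ) = m + 1 by omega, ← sigmaLE_eq_sigmaLT]

section Kernels

variable {p : ℝ} (hp : p ∈ Ioo (0 : ℝ) 1)
include hp

lemma lintegral_lis {l m : ℤ} (hlm : l ≤ m) {f : Config' → ℝ≥0∞} (hf : Measurable[sigmaLE m] f)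
    (ω : Config') : ∫⁻ ξ, f ξ ∂(lis p l m ω) = steps p l (m + 1 - l).toNat f ω := by
  have hk : m + 1 = l + ((m + 1 - l).toNat : ℤ) := by omega
  have hd : SpinDependsOn f (Iio (l + ((m + 1 - l).toNat : ℤ))) := by
    rw [← hk]
    exact spinDependsOn_of_measurable (by rwa [sigmaLE_eq_sigmaLT] at hf)
  rw [← sum_blockWeight_eq_steps hp l _ m hk hd, lis, lintegral_finsetSum_measure]
  refine Finset.sum_congr rfl fun x _ => ?_
  rw [lintegral_smul_measure, @lintegral_dirac' _ (sigmaLE m) _ _ hf, prod_splice, smul_eq_mul]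

lemma lis_apply {l m : ℤ} (hlm : l ≤ m) {A : Set Config'} (hA : MeasurableSet[sigmaLE m] A)
    (ω : Config') : lis p l m ω A = steps p l (m + 1 - l).toNat (A.indicator 1) ω := by
  rw [← lintegral_lis hp hlm (measurable_indicator_one hA), @lintegral_indicator_one _ (sigmaLE m) _ _ hA]

lemma isLIS_lis : IsLIS (lis p) where
  prob l m hlm ω := by
    rw [lis_apply hp hlm MeasurableSet.univ, indicator_univ,
      steps_of_spinDependsOn hp fun _ _ _ => rfl]
    rfl
  measurable l m hlm A hA := by
    simp_rw [lis_apply hp hlm hA]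
    exact measurable_steps_toNat p hlm (measurable_indicator_one hA)
  proper l m hlm B hB ω := by
    have hB' : MeasurableSet[sigmaLE m] B :=
      sigmaOn_mono (fun j hj => (mem_Iio.1 hj).le.trans hlm) _ hB
    rw [lis_apply hp hlm hB', steps_of_spinDependsOn hp]
    exact spinDependsOn_of_measurable (measurable_indicator_one hB)
  consistent l m l' m' hlm hl hm f hf ω := by
    have hm' : sigmaLE m ≤ sigmaLE m' := sigmaOn_mono (Iic_subset_Iic.2 hm)
    have hl' : sigmaLT l ≤ sigmaLE m' :=
      sigmaOn_mono fun j hj => (mem_Iio.1 hj).le.trans (hlm.trans hm)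
    have hg := measurable_steps_toNat p hlm hf
    simp_rw [lintegral_lis hp hlm hf]
    -- Both sides are cut at `l`, and the right side also at `m + 1`. On the left, averaging from
    -- `l` on leaves the inner integral alone, as it depends only on spins before `l`; on the right,
    -- averaging beyond `m` leaves `f` alone.
    rw [lintegral_lis hp (by omega) (hg.mono hl' le_rfl),
      lintegral_lis hp (by omega) (hf.mono hm' le_rfl),
      show (m' + 1 - l').toNat = (l - l').toNat + (m' + 1 - l).toNat by omega,
      steps_add, steps_add, show l' + ((l - l').toNat : ℤ) = l by omega,
      steps_of_spinDependsOn hp (spinDependsOn_of_measurable hg),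
      show (m' + 1 - l).toNat = (m + 1 - l).toNat + (m' - m).toNat by omega, steps_add,
      show l + ((m + 1 - l).toNat : ℤ) = m + 1 by omega, steps_of_spinDependsOn hp (l := m + 1)]
    rw [sigmaLE_eq_sigmaLT] at hf
    exact spinDependsOn_of_measurable hf

lemma lis_single_apply (i : ℤ) (ω : Config') :
    lis p i i ω {η | η.1 i = false} = ENNReal.ofReal (gFun p (pairDist ω.1 i)) := by
  rw [lis_apply hp le_rfl (measurableSet_sigmaOn_apply_eq (by simp) false),
    show (i + 1 - i).toNat = 1 by omega]
  simp [steps, step, weight, indicator, extend_apply_self, spinProb]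

end Kernels

/-! ### Uniqueness of the consistent measure -/

/-- On configurations with a pair of ones at `(s, s + 1)`, the function `f` only depends on the
spins in `[s, i)`. -/
def PairLocal (s i : ℤ) (f : Config' → ℝ≥0∞) : Prop :=
  ∀ ⦃ω η : Config'⦄, (∀ j, s ≤ j → j < i → ω.1 j = η.1 j) → ω.1 s = true → ω.1 (s + 1) = true →
    f ω = f η

/-- The pair at `(s, s + 1)` fixes the distance at `i` independently of what lies left of `s`, so
the weights agree; extensions of positive weight preserve the pair. -/
lemma PairLocal.step {p : ℝ} {s i : ℤ} {f : Config' → ℝ≥0∞} (hsi : s + 1 < i)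
    (hf : PairLocal s (i + 1) f) : PairLocal s i (step p i f) := by
  intro ω η h h0 h1
  have hd := pairDist_of_pair_of_agree hsi h h0 h1
  simp only [TBF.step]
  refine Finset.sum_congr rfl fun b _ => ?_
  have hw : weight p i ω b = weight p i η b := by rw [weight, weight, hd]
  rw [← hw]
  by_cases hb : weight p i ω b = 0
  · simp [hb]
  have hω : ∀ j < i, (extend i ω b).1 j = ω.1 j := fun j hj =>
    extend_apply_of_lt (eq_true_of_weight_ne_zero hb) hj
  have hη : ∀ j < i, (extend i η b).1 j = η.1 j := fun j hj =>
    extend_apply_of_lt (eq_true_of_weight_ne_zero (hw ▸ hb)) hj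
  congr 1
  refine hf (fun j hj hji => ?_) ((hω s (by omega)).trans h0) ((hω _ hsi).trans h1)
  rcases eq_or_ne j i with rfl | hne
  · rw [extend_apply_self, extend_apply_self]
  · rw [hω j (by omega), hη j (by omega), h j hj (by omega)]

lemma PairLocal.steps {p : ℝ} {s l : ℤ} {k : ℕ} {f : Config' → ℝ≥0∞} (hsl : s + 1 < l)
    (hf : PairLocal s (l + k) f) : PairLocal s l (steps p l k f) := by
  induction k generalizing f with
  | zero => rwa [Nat.cast_zero, add_zero] at hf
  | succ k ih =>
    refine ih (PairLocal.step (by omega) ?_)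
    rwa [add_assoc, ← Nat.cast_succ]

/-- Doeblin's argument: mass `ε` is committed to the common value `c`, and only the remaining `1 -
ε` can spread over the interval of length `δ`. The new interval depends on `c`, not on the
individual weights. -/
lemma convex_combination_contract {ι : Type*} [Fintype ι] {w x : ι → ℝ} {i₀ : ι} {ε m δ c : ℝ}
    (hw : ∀ i, 0 ≤ w i) (hw1 : ∑ i, w i = 1) (hε : ε ≤ w i₀) (hx : ∀ i, m ≤ x i ∧ x i ≤ m + δ)
    (hc : x i₀ = c) :
    m + ε * (c - m) ≤ ∑ i, w i * x i ∧
      ∑ i, w i * x i ≤ m + ε * (c - m) + (1 - ε) * δ := by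
  have hlow : w i₀ * (x i₀ - m) ≤ ∑ i, w i * (x i - m) :=
    Finset.single_le_sum (f := fun i => w i * (x i - m))
      (fun i _ => mul_nonneg (hw i) (sub_nonneg.2 (hx i).1)) (Finset.mem_univ i₀)
  have hup : w i₀ * (m + δ - x i₀) ≤ ∑ i, w i * (m + δ - x i) :=
    Finset.single_le_sum (f := fun i => w i * (m + δ - x i))
      (fun i _ => mul_nonneg (hw i) (sub_nonneg.2 (hx i).2)) (Finset.mem_univ i₀)
  simp only [mul_sub, Finset.sum_sub_distrib, ← Finset.sum_mul, hw1] at hlow hup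
  subst hc
  have h1 := mul_le_mul_of_nonneg_right hε (sub_nonneg.2 (hx i₀).1)
  have h2 := mul_le_mul_of_nonneg_right hε (sub_nonneg.2 (hx i₀).2)
  constructor <;> linarith

/-! ### Loss of memory and its consequence for consistent measures. -/

section Contraction

variable {p : ℝ} (hp : p ∈ Ioo (0 : ℝ) 1)
include hp

lemma step_le_one {i : ℤ} {f : Config' → ℝ≥0∞} (hf : ∀ ω, f ω ≤ 1) (ω : Config') :
    step p i f ω ≤ 1 := by
  rw [step, ← sum_weight hp i ω]
  exact Finset.sum_le_sum fun b _ => mul_le_of_le_one_right' (hf _)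

lemma steps_le_one {l : ℤ} (k : ℕ) {f : Config' → ℝ≥0∞} (hf : ∀ ω, f ω ≤ 1) (ω : Config') :
    steps p l k f ω ≤ 1 := by
  induction k generalizing f with
  | zero => exact hf ω
  | succ k ih => exact ih (step_le_one hp hf)

lemma toReal_step {i : ℤ} {f : Config' → ℝ≥0∞} (hf : ∀ ω, f ω ≤ 1) (ω : Config') :
    (step p i f ω).toReal =
      ∑ b, spinProb p (pairDist ω.1 i) b * (f (extend i ω b)).toReal := by
  simp only [step, weight]
  rw [ENNReal.toReal_sum fun b _ => ENNReal.mul_ne_top ENNReal.ofReal_ne_top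
    ((hf _).trans_lt ENNReal.one_lt_top).ne]
  simp only [ENNReal.toReal_mul, ENNReal.toReal_ofReal (spinProb_nonneg hp _ _)]

/-- Sampling two spins reduces the oscillation of a function that is constant on configurations
ending with a pair of ones. -/
lemma exists_bounds_steps_two {ε : ℝ} (hε : 0 < ε) (hg : ∀ n, ε ≤ 1 - gFun p n) {l : ℤ}
    {h : Config' → ℝ≥0∞} (h1 : ∀ ω, h ω ≤ 1) (hl : PairLocal l (l + 2) h) {δ : ℝ}
    (hb : ∃ m, ∀ ω, m ≤ (h ω).toReal ∧ (h ω).toReal ≤ m + δ) :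
    ∃ m, ∀ ω, m ≤ (steps p l 2 h ω).toReal ∧ (steps p l 2 h ω).toReal ≤ m + (1 - ε ^ 2) * δ := by
  obtain ⟨m, hm⟩ := hb
  set o : Config' := thin' fun _ => true
  refine ⟨m + ε ^ 2 * ((h o).toReal - m), fun ω => ?_⟩
  have hsum : (steps p l 2 h ω).toReal = ∑ b : Bool × Bool,
      (spinProb p (pairDist ω.1 l) b.1 *
        spinProb p (pairDist (extend l ω b.1).1 (l + 1)) b.2) *
        (h (extend (l + 1) (extend l ω b.1) b.2)).toReal := by
    simp only [steps, Nat.cast_zero, Nat.cast_one, add_zero]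
    rw [toReal_step hp (step_le_one hp h1), Fintype.sum_prod_type]
    simp only [toReal_step hp h1, Finset.mul_sum, mul_assoc]
  rw [hsum]
  -- After drawing two ones, `h` takes the same value for every past `ω`, namely its value at the
  -- all-ones configuration `o`.
  refine convex_combination_contract (i₀ := (true, true))
    (fun b => mul_nonneg (spinProb_nonneg hp _ _) (spinProb_nonneg hp _ _)) ?_ ?_
    (fun b => hm _) ?_
  · simp [Fintype.sum_prod_type, spinProb]
    ring
  · rw [sq]
    exact mul_le_mul (hg _) (hg _) hε.le (hε.le.trans (hg _))
  · congr 1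
    have ha : (extend (l + 1) (extend l ω true) true).1 l = true := by
      rw [extend_apply_of_lt (fun _ => rfl) (by omega), extend_apply_self]
    have hb : (extend (l + 1) (extend l ω true) true).1 (l + 1) = true := extend_apply_self _ _ _
    refine hl (fun j hj hj' => ?_) ha hb
    have ho : o.1 j = true := rfl
    obtain rfl | rfl : j = l ∨ j = l + 1 := by omega
    · rw [ha, ho]
    · rw [hb, ho]

lemma exists_bounds_steps {ε : ℝ} (hε : 0 < ε) (hg : ∀ n, ε ≤ 1 - gFun p n) {a : ℤ} {k : ℕ}
    {f : Config' → ℝ≥0∞} (h1 : ∀ ω, f ω ≤ 1) (hf : SpinDependsOn f (Ico a (a + k))) (n : ℕ) :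
    ∃ m, ∀ ω, m ≤ (steps p (a - 2 * n) (2 * n + k) f ω).toReal ∧
      (steps p (a - 2 * n) (2 * n + k) f ω).toReal ≤ m + (1 - ε ^ 2) ^ n := by
  induction n with
  | zero =>
    -- Initial oscillation is at most `1`, since `f` takes values in `[0, 1]`.
    refine ⟨0, fun ω => ⟨ENNReal.toReal_nonneg, ?_⟩⟩
    rw [pow_zero, zero_add]
    exact ENNReal.toReal_le_of_le_ofReal zero_le_one (by simpa using steps_le_one hp _ h1 ω)
  | succ n ih =>
    have hl : a - 2 * ((n + 1 : ℕ) : ℤ) + ((2 : ℕ) : ℤ) = a - 2 * n := by push_cast; ring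
    rw [show 2 * (n + 1) + k = 2 + (2 * n + k) by ring, steps_add, hl, pow_succ']
    refine exists_bounds_steps_two hp hε hg (steps_le_one hp _ h1) ?_ ih
    rw [show a - 2 * ((n + 1 : ℕ) : ℤ) + 2 = a - 2 * n by push_cast; ring]
    refine PairLocal.steps (by push_cast; omega) fun ω η h _ _ => hf fun j hj => h j ?_ ?_
    · have := hj.1
      push_cast
      omega
    · have := hj.2
      push_cast
      omega

lemma IsConsistent.lintegral_steps {ν : Measure Config'} (hν : IsConsistent (lis p) ν) (l : ℤ)
    (k : ℕ) {f : Config' → ℝ≥0∞} (hf : Measurable[sigmaLT (l + k)] f) :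
    ∫⁻ ω, steps p l k f ω ∂ν = ∫⁻ ω, f ω ∂ν := by
  cases k with
  | zero => rfl
  | succ k =>
    have hf' : Measurable[sigmaLE (l + k)] f := by
      rw [sigmaLE_eq_sigmaLT]
      rwa [Nat.cast_succ, ← add_assoc] at hf
    have := hν.consistent l (l + k) (by omega) f hf'
    simp_rw [lintegral_lis hp (show l ≤ l + (k : ℤ) by omega) hf'] at this
    rwa [show (l + (k : ℤ) + 1 - l).toNat = k + 1 by omega] at this

/-- Integrating the nearly constant function of `exists_bounds_steps` puts `ν A` in an interval of
length `(1 - ε ^ 2) ^ n` that is the same for every consistent `ν`. -/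
lemma IsConsistent.measure_eq {ν₁ ν₂ : Measure Config'} (h₁ : IsConsistent (lis p) ν₁)
    (h₂ : IsConsistent (lis p) ν₂) {a : ℤ} {k : ℕ} {A : Set Config'}
    (hA : MeasurableSet[sigmaOn (Ico a (a + k))] A) : ν₁ A = ν₂ A := by
  obtain ⟨ε, hε, hg⟩ := exists_le_one_sub_gFun hp
  have hε1 : ε ≤ 1 := by simpa [gFun_zero] using hg 0
  have hf := measurable_indicator_one hA
  have h1 : ∀ ω, A.indicator (1 : Config' → ℝ≥0∞) ω ≤ 1 := fun ω =>
    indicator_le_self' (fun _ _ => zero_le_one) ω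
  have hAm : MeasurableSet A := sigmaOn_le _ _ hA
  have hbound : ∀ n : ℕ, ∃ m, ∀ ν : Measure Config', IsConsistent (lis p) ν →
      m ≤ ν.real A ∧ ν.real A ≤ m + (1 - ε ^ 2) ^ n := by
    intro n
    obtain ⟨m, hm⟩ := exists_bounds_steps hp hε hg h1 (spinDependsOn_of_measurable hf) n
    refine ⟨m, fun ν hν => ?_⟩
    have := hν.prob
    have hm0 : 0 ≤ m + (1 - ε ^ 2) ^ n := by
      let o : Config' := thin' fun _ => true
      exact ENNReal.toReal_nonneg.trans (hm o).2
    have hint : ν A = ∫⁻ ω, steps p (a - 2 * n) (2 * n + k) (A.indicator 1) ω ∂ν := by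
      rw [hν.lintegral_steps hp, lintegral_indicator_one hAm]
      refine hf.mono (sigmaOn_mono fun j hj => ?_) le_rfl
      have := hj.2
      simp only [mem_Iio]
      push_cast
      omega
    have hfin : ∀ ω, steps p (a - 2 * n) (2 * n + k) (A.indicator 1) ω ≠ ∞ := fun ω =>
      ((steps_le_one hp _ h1 ω).trans_lt ENNReal.one_lt_top).ne
    constructor
    · rw [measureReal_def, ← ENNReal.ofReal_le_iff_le_toReal (measure_ne_top _ _), hint]
      calc ENNReal.ofReal m = ∫⁻ _, ENNReal.ofReal m ∂ν := by simp
        _ ≤ _ := lintegral_mono fun ω => ENNReal.ofReal_le_of_le_toReal (hm ω).1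
    · refine ENNReal.toReal_le_of_le_ofReal hm0 ?_
      rw [hint]
      calc _ ≤ ∫⁻ _, ENNReal.ofReal (m + (1 - ε ^ 2) ^ n) ∂ν :=
            lintegral_mono fun ω => (ENNReal.le_ofReal_iff_toReal_le (hfin ω) hm0).2 (hm ω).2
        _ = _ := by simp
  have := h₁.prob
  have := h₂.prob
  have hdist : dist (ν₁.real A) (ν₂.real A) ≤ 0 := by
    have hlim : Filter.Tendsto (fun n : ℕ => (1 - ε ^ 2) ^ n) Filter.atTop (nhds 0) :=
      tendsto_pow_atTop_nhds_zero_of_lt_one (by nlinarith) (by nlinarith)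
    refine ge_of_tendsto' hlim fun n => ?_
    obtain ⟨m, hm⟩ := hbound n
    have ha := hm ν₁ h₁
    have hb := hm ν₂ h₂
    rw [Real.dist_eq, abs_le]
    constructor <;> linarith
  exact (measureReal_eq_measureReal_iff).1 (dist_le_zero.1 hdist)

lemma IsConsistent.unique {ν₁ ν₂ : Measure Config'} (h₁ : IsConsistent (lis p) ν₁)
    (h₂ : IsConsistent (lis p) ν₂) : ν₁ = ν₂ := by
  have := h₁.prob
  have := h₂.prob
  refine ext_of_generate_finite
    (preimage (Subtype.val : Config' → Config) '' measurableCylinders fun _ : ℤ => Bool) ?_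
    ?_ ?_ (by simp)
  · rw [← MeasurableSpace.comap_generateFrom, generateFrom_measurableCylinders]
    rfl
  · convert isPiSystem_measurableCylinders.comap (Subtype.val : Config' → Config) using 1
    rfl
  · rintro _ ⟨t, ht, rfl⟩
    obtain ⟨s, S, hS, rfl⟩ := (mem_measurableCylinders _).1 ht
    obtain ⟨a, ha⟩ := s.bddBelow
    obtain ⟨c, hc⟩ := s.bddAbove
    refine h₁.measure_eq hp h₂ (a := a) (k := (c + 1 - a).toNat) ⟨_, ?_, rfl⟩
    have hr : @Measurable _ _ (cylinderEvents (Ico a (a + ((c + 1 - a).toNat : ℤ)))) _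
        (s.restrict : Config → _) := by
      rw [@measurable_pi_iff]
      intro j
      refine measurable_cylinderEvent_apply (X := fun _ : ℤ => Bool) ?_
      have h1 := ha j.2
      have h2 := hc j.2
      simp only [mem_Ico]
      omega
    exact hr hS

end Contraction

/-! ### The thinned Bernoulli field is consistent -/

instance (q : unitInterval) : IsProbabilityMeasure (bernoulliField q) := by
  unfold bernoulliField
  infer_instance

lemma indep_cylinderEvents (q : unitInterval) {S T : Set ℤ} (h : Disjoint S T) :
    ProbabilityTheory.Indep (cylinderEvents (X := fun _ : ℤ => Bool) S)
      (cylinderEvents (X := fun _ : ℤ => Bool) T) (bernoulliField q) :=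
  ProbabilityTheory.indep_iSup_of_disjoint
    (fun i => measurable_iff_comap_le.1 (measurable_pi_apply i))
    (ProbabilityTheory.iIndepFun_infinitePi (X := fun _ b => b) fun _ => measurable_id) h

lemma bernoulliField_inter (q : unitInterval) {S T : Set ℤ} (h : Disjoint S T) {A B : Set Config}
    (hA : MeasurableSet[cylinderEvents S] A) (hB : MeasurableSet[cylinderEvents T] B) :
    bernoulliField q (A ∩ B) = bernoulliField q A * bernoulliField q B :=
  ProbabilityTheory.Indep_iff _ _ _ |>.1 (indep_cylinderEvents q h) A B hA hB

lemma bernoulliField_eval_preimage (q : unitInterval) (i : ℤ) (S : Set Bool) :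
    bernoulliField q {ω | ω i ∈ S} = ProbabilityTheory.bernoulliMeasure true false q S :=
  (measurePreserving_eval_infinitePi (fun _ : ℤ => ProbabilityTheory.bernoulliMeasure true false q)
    i).measure_preimage (MeasurableSet.of_discrete).nullMeasurableSet

lemma bernoulliField_apply_true (q : unitInterval) (i : ℤ) :
    bernoulliField q {ω | ω i = true} = ENNReal.ofReal q := by
  refine (bernoulliField_eval_preimage q i {true}).trans ?_
  rw [ProbabilityTheory.bernoulliMeasure_apply_of_mem_of_notMem _ MeasurableSet.of_discrete
    (by simp) (by simp)]
  exact (ENNReal.ofReal_eq_coe_nnreal q.2.1).symm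

lemma bernoulliField_apply_false (q : unitInterval) (i : ℤ) :
    bernoulliField q {ω | ω i = false} = ENNReal.ofReal (1 - q) := by
  refine (bernoulliField_eval_preimage q i {false}).trans ?_
  rw [ProbabilityTheory.bernoulliMeasure_apply_of_notMem_of_mem _ MeasurableSet.of_discrete
    (by simp) (by simp)]
  exact (ENNReal.ofReal_eq_coe_nnreal (sub_nonneg.2 q.2.2)).symm

lemma measurableSet_cylinderEvents_apply_eq {Δ : Set ℤ} {j : ℤ} (hj : j ∈ Δ) (b : Bool) :
    MeasurableSet[cylinderEvents Δ] {ω : Config | ω j = b} :=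
  measurable_cylinderEvent_apply (X := fun _ : ℤ => Bool) hj (measurableSet_singleton b)

/-! ### Gaps of the thinned field as events of the Bernoulli field. -/

/-- There are no two adjacent ones in `[s, s + n)`. -/
def noPair (s : ℤ) (n : ℕ) : Set Config :=
  {ω | ∀ j, s ≤ j → j + 1 < s + n → ¬(ω j = true ∧ ω (j + 1) = true)}

lemma measurableSet_noPair (s : ℤ) (n : ℕ) :
    MeasurableSet[cylinderEvents (Ico s (s + n))] (noPair s n) := by
  let _ : MeasurableSpace Config := cylinderEvents (Ico s (s + n))
  have : noPair s n = ⋂ j ∈ {j : ℤ | s ≤ j ∧ j + 1 < s + n},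
      ({ω | ω j = true} ∩ {ω | ω (j + 1) = true})ᶜ := by
    ext ω
    simp [noPair]
  rw [this]
  refine MeasurableSet.biInter (to_countable _) fun j hj => MeasurableSet.compl ?_
  exact (measurableSet_cylinderEvents_apply_eq (mem_Ico.2 ⟨hj.1, by have := hj.2; omega⟩) _).inter
    (measurableSet_cylinderEvents_apply_eq (mem_Ico.2 ⟨by have := hj.1; omega, hj.2⟩) _)

lemma noPair_anti (s : ℤ) (n : ℕ) : noPair s (n + 1) ⊆ noPair s n :=
  fun _ h j hj hj' => h j hj (by push_cast; omega)

/-- Splitting by the last spin: if it is a one, the spin before it must be zero. This is the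
recursion of `noPairWeight` at the level of events. -/
lemma noPair_add_two (s : ℤ) (n : ℕ) : noPair s (n + 2) =
    (noPair s (n + 1) ∩ {ω | ω (s + n + 1) = false}) ∪
      (noPair s n ∩ ({ω | ω (s + n) = false} ∩ {ω | ω (s + n + 1) = true})) := by
  ext ω
  constructor
  · intro h
    cases hb : ω (s + n + 1)
    · exact Or.inl ⟨noPair_anti _ _ h, hb⟩
    · refine Or.inr ⟨noPair_anti _ _ (noPair_anti _ _ h), ?_, hb⟩
      have := h (s + n) (by omega) (by push_cast; omega)
      simpa [hb] using this
  · rintro (⟨h, h0⟩ | ⟨h, h0, h1⟩) j hj hj' ⟨ha, hb⟩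
    · simp only [mem_ofPred_eq] at h0
      by_cases hjn : j + 1 < s + (n + 1 : ℕ)
      · exact h j hj hjn ⟨ha, hb⟩
      · rw [show j + 1 = s + n + 1 by push_cast at hjn hj'; omega, h0] at hb
        exact absurd hb (by simp)
    · simp only [mem_ofPred_eq] at h0 h1
      by_cases hjn : j + 1 < s + (n : ℕ)
      · exact h j hj hjn ⟨ha, hb⟩
      · have : j = s + n ∨ j + 1 = s + n := by push_cast at hj'; omega
        rcases this with rfl | h'
        · rw [h0] at ha
          exact absurd ha (by simp)
        · rw [h', h0] at hb
          exact absurd hb (by simp)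

/-- The thinned configuration vanishes on `(k, k + n]`, provided that `k` is occupied. -/
def gap (k : ℤ) : ℕ → Set Config
  | 0 => univ
  | n + 1 => {ω | ω (k + 1) = false} ∩ noPair (k + 2) (n + 1)

lemma measurableSet_gap (k : ℤ) (n : ℕ) : MeasurableSet[cylinderEvents (Ioi k)] (gap k n) := by
  cases n with
  | zero => exact MeasurableSet.univ
  | succ n =>
    refine MeasurableSet.inter (measurableSet_cylinderEvents_apply_eq (by simp) _) ?_
    refine cylinderEvents_mono (fun j hj => ?_) _ (measurableSet_noPair (k + 2) (n + 1))
    have := hj.1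
    simp only [mem_Ioi]
    omega

lemma gap_anti (k : ℤ) : ∀ n, gap k (n + 1) ⊆ gap k n
  | 0 => subset_univ _
  | _ + 1 => inter_subset_inter_right _ (noPair_anti _ _)

/-- A one at `k + 1` would be kept by its neighbour `k`, hence `k + 1` must be empty. The no-pair
window reaches one site beyond the gap, since the right neighbour of `k + n` decides whether a one
at `k + n` survives. -/
lemma mem_gap_iff {k : ℤ} {n : ℕ} {ω : Config} (hk : ω k = true) :
    ω ∈ gap k n ↔ ∀ j, k < j → j < k + n + 1 → thin ω j = false := by
  cases n with
  | zero => exact iff_of_true trivial fun j hj hj' => by push_cast at hj'; omega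
  | succ n =>
    constructor
    · rintro ⟨h0, h⟩ j hj hj'
      simp only [mem_ofPred_eq] at h0
      push_cast at hj'
      rw [thin, Bool.and_eq_false_imp]
      intro hj1
      have hne : j ≠ k + 1 := fun he => by rw [he, h0] at hj1; exact absurd hj1 (by simp)
      rw [Bool.or_eq_false_iff]
      constructor
      · rcases eq_or_ne (j - 1) (k + 1) with he | he
        · rw [he, h0]
        · have := h (j - 1) (by omega) (by push_cast; omega)
          rw [sub_add_cancel] at this
          simpa [hj1] using this
      · have := h j (by omega) (by push_cast; omega)
        simpa [hj1] using this
    · intro h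
      constructor
      · have := h (k + 1) (by omega) (by push_cast; omega)
        simpa [thin, hk] using this
      · rintro j hj hj' ⟨ha, hb⟩
        push_cast at hj'
        have := h j (by omega) (by push_cast; omega)
        simp [thin, ha, hb] at this

lemma measurable_thin' : Measurable thin' := by
  refine Measurable.subtype_mk (measurable_pi_iff.2 fun i => ?_)
  have h3 : Measurable fun x : Bool × Bool × Bool => (x.1 && (x.2.1 || x.2.2)) :=
    measurable_of_countable _
  have h : Measurable fun ω : Config => (ω i, ω (i - 1), ω (i + 1)) := by fun_prop
  exact h3.comp h

instance (q : unitInterval) : IsProbabilityMeasure (thinnedField q) :=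
  Measure.isProbabilityMeasure_map measurable_thin'.aemeasurable

/-- There are ones at `k - 1` and `k`. -/
def pairAt (k : ℤ) : Set Config := {ω | ω (k - 1) = true} ∩ {ω | ω k = true}

lemma measurableSet_pairAt (k : ℤ) : MeasurableSet[cylinderEvents (Iic k)] (pairAt k) :=
  MeasurableSet.inter (measurableSet_cylinderEvents_apply_eq (by simp) _)
    (measurableSet_cylinderEvents_apply_eq (by simp) _)

lemma pairDist_thin'_eq_iff (k : ℤ) (n : ℕ) (ω : Config) :
    pairDist (thin' ω).1 (k + n + 1) = ((n + 1 : ℕ) : ℕ∞) ↔ ω ∈ pairAt k ∩ gap k n := by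
  rw [pairDist_eq_succ_iff, show k + (n : ℤ) + 1 - n - 2 = k - 1 by ring,
    show k + (n : ℤ) + 1 - n - 1 = k by ring, mem_inter_iff, pairAt, mem_inter_iff, and_assoc]
  simp only [mem_ofPred_eq]
  constructor
  · rintro ⟨h1, h2, h3⟩
    have h1' : ω (k - 1) = true := by simp only [thin'_apply, Bool.and_eq_true] at h1; exact h1.1
    have h2' : ω k = true := by simp only [thin'_apply, Bool.and_eq_true] at h2; exact h2.1
    exact ⟨h1', h2', (mem_gap_iff h2').2 h3⟩
  · rintro ⟨h1, h2, h3⟩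
    exact ⟨by simp [thin'_apply, h1, h2], by simp [thin'_apply, h1, h2], (mem_gap_iff h2).1 h3⟩

/-- Keep `ω` up to `k`, put `n` zeros to the right of `k`, followed by `b` and by ones. -/
def fill (k : ℤ) (n : ℕ) (b : Bool) (ω : Config) : Config := fun j =>
  if j ≤ k then ω j else if j < k + n + 1 then false else if j = k + n + 1 then b else true

lemma measurable_fill (k : ℤ) (n : ℕ) (b : Bool) :
    Measurable[cylinderEvents (Iic k)] (fill k n b) := by
  let _ : MeasurableSpace Config := cylinderEvents (Iic k)
  rw [@measurable_pi_iff]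
  intro j
  simp only [fill]
  split_ifs with h
  · exact measurable_cylinderEvent_apply (X := fun _ : ℤ => Bool) h
  · exact measurable_const
  · exact measurable_const
  · exact measurable_const

/-- This makes the thinned past a function of the Bernoulli spins up to `k` alone. The occupied `k -
1` protects the one at `k` even though `fill` may change the spin at `k + 1`. -/
lemma thin'_fill_apply {k : ℤ} {n : ℕ} {ω : Config} (hω : ω ∈ pairAt k ∩ gap k n) (b : Bool)
    {j : ℤ} (hj : j < k + n + 1) : (thin' (fill k n b ω)).1 j = (thin' ω).1 j := by
  obtain ⟨⟨h1, h2⟩, h3⟩ := hω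
  simp only [mem_ofPred_eq] at h1 h2
  rw [thin'_apply, thin'_apply]
  rcases lt_trichotomy j k with h | rfl | h
  · simp only [fill, if_pos h.le, if_pos (show j - 1 ≤ k by omega),
      if_pos (show j + 1 ≤ k by omega)]
  · simp [fill, h1, h2]
  · have := (mem_gap_iff h2).1 h3 j h hj
    rw [thin] at this
    rw [this, fill, if_neg (by omega), if_pos hj, Bool.false_and]

lemma thin'_fill_apply_self (k : ℤ) (n : ℕ) (ω : Config) (b : Bool) :
    (thin' (fill k n b ω)).1 (k + n + 1) = b := by
  have h1 : fill k n b ω (k + n + 1) = b := by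
    rw [fill, if_neg (by omega), if_neg (by omega), if_pos rfl]
  have h2 : fill k n b ω (k + n + 1 + 1) = true := by
    rw [fill, if_neg (by omega), if_neg (by omega), if_neg (by omega)]
  rw [thin'_apply, h1, h2]
  simp

/-- The event that the thinned spin at `k + n + 1` is `b` after a gap. -/
def gapThen (k : ℤ) (n : ℕ) (b : Bool) : Set Config :=
  if b then gap k n \ gap k (n + 1) else gap k (n + 1)

lemma measurableSet_gapThen (k : ℤ) (n : ℕ) (b : Bool) :
    MeasurableSet[cylinderEvents (Ioi k)] (gapThen k n b) := by
  unfold gapThen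
  split_ifs
  · exact MeasurableSet.diff (measurableSet_gap _ _) (measurableSet_gap _ _)
  · exact measurableSet_gap _ _

lemma mem_gapThen_iff {k : ℤ} {n : ℕ} {ω : Config} (hk : ω k = true) (b : Bool) :
    ω ∈ gapThen k n b ↔ ω ∈ gap k n ∧ thin ω (k + n + 1) = b := by
  have h : ω ∈ gap k (n + 1) ↔ ω ∈ gap k n ∧ thin ω (k + n + 1) = false := by
    rw [mem_gap_iff hk, mem_gap_iff hk]
    push_cast
    constructor
    · exact fun h => ⟨fun j hj hj' => h j hj (by omega), h _ (by omega) (by omega)⟩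
    · rintro ⟨h1, h2⟩ j hj hj'
      rcases eq_or_ne j (k + n + 1) with rfl | hne
      · exact h2
      · exact h1 j hj (by omega)
  cases b
  · exact h
  · simp only [gapThen, if_true, mem_sdiff, h, not_and, Bool.not_eq_false]
    exact ⟨fun h => ⟨h.1, h.2 h.1⟩, fun h => ⟨h.1, fun _ => h.2⟩⟩

/-! ### Gap probabilities and consistency of the thinned field. -/

section Field

variable {q : unitInterval} (hq : (q : ℝ) ∈ Ioo (0 : ℝ) 1)
include hq

lemma bernoulliField_noPair (s : ℤ) :
    ∀ n : ℕ, bernoulliField q (noPair s n) = ENNReal.ofReal (noPairWeight q n)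
  | 0 => by
    have : noPair s 0 = univ := eq_univ_of_forall fun ω j hj hj' => by push_cast at hj'; omega
    rw [this, measure_univ, noPairWeight, ENNReal.ofReal_one]
  | 1 => by
    have : noPair s 1 = univ := eq_univ_of_forall fun ω j hj hj' => by push_cast at hj'; omega
    rw [this, measure_univ, noPairWeight, ENNReal.ofReal_one]
  | n + 2 => by
    have hq0 := hq.1.le
    have hq1 : 0 ≤ 1 - (q : ℝ) := sub_nonneg.2 hq.2.le
    have hu := noPairWeight_pos hq n
    have hu1 := noPairWeight_pos hq (n + 1)
    have hm : ∀ (j : ℤ) (b : Bool), MeasurableSet {ω : Config | ω j = b} := fun j b =>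
      cylinderEvents_le_pi _ (measurableSet_cylinderEvents_apply_eq (mem_univ j) b)
    have hV : MeasurableSet (noPair s n) :=
      cylinderEvents_le_pi _ (measurableSet_noPair s n)
    have hd1 : Disjoint (Ico s (s + (n + 1 : ℕ))) {s + (n : ℤ) + 1} := by
      rw [disjoint_singleton_right]
      intro h
      have := h.2
      push_cast at this
      omega
    have hd2 : Disjoint (Ico s (s + n)) {s + (n : ℤ), s + (n : ℤ) + 1} := by
      rw [disjoint_left]
      intro j hj hj'
      have := hj.2
      simp only [mem_insert_iff, mem_singleton_iff] at hj'
      omega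
    have hd3 : Disjoint ({s + (n : ℤ)} : Set ℤ) {s + (n : ℤ) + 1} := by simp
    have hA : bernoulliField q (noPair s (n + 1) ∩ {ω | ω (s + n + 1) = false}) =
        ENNReal.ofReal (noPairWeight q (n + 1) * (1 - q)) := by
      rw [bernoulliField_inter q hd1 (measurableSet_noPair s (n + 1))
        (measurableSet_cylinderEvents_apply_eq (mem_singleton _) _), bernoulliField_noPair s (n + 1),
        bernoulliField_apply_false, ENNReal.ofReal_mul hu1.le]
    have hB : bernoulliField q
        (noPair s n ∩ ({ω | ω (s + n) = false} ∩ {ω | ω (s + n + 1) = true})) =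
        ENNReal.ofReal (noPairWeight q n * ((1 - q) * q)) := by
      rw [bernoulliField_inter q hd2 (measurableSet_noPair s n)
          ((measurableSet_cylinderEvents_apply_eq (mem_insert _ _) _).inter
            (measurableSet_cylinderEvents_apply_eq (mem_insert_of_mem _ (mem_singleton _)) _)),
        bernoulliField_inter q hd3 (measurableSet_cylinderEvents_apply_eq (mem_singleton _) _)
          (measurableSet_cylinderEvents_apply_eq (mem_singleton _) _),
        bernoulliField_noPair s n, bernoulliField_apply_true, bernoulliField_apply_false,
        ENNReal.ofReal_mul hu.le, ENNReal.ofReal_mul hq1]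
    have hd : Disjoint (noPair s (n + 1) ∩ {ω | ω (s + n + 1) = false})
        (noPair s n ∩ ({ω | ω (s + n) = false} ∩ {ω | ω (s + n + 1) = true})) := by
      rw [disjoint_left]
      rintro ω ⟨-, h⟩ ⟨-, -, h'⟩
      simp only [mem_ofPred_eq] at h h'
      rw [h] at h'
      exact absurd h' (by simp)
    rw [noPair_add_two, measure_union hd (hV.inter ((hm _ _).inter (hm _ _))), hA, hB,
      ← ENNReal.ofReal_add (mul_nonneg hu1.le hq1) (mul_nonneg hu.le (mul_nonneg hq1 hq0)),
      noPairWeight]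
    congr 1
    ring

lemma bernoulliField_gap (k : ℤ) (n : ℕ) :
    bernoulliField q (gap k n) = ENNReal.ofReal (gapWeight q n) := by
  cases n with
  | zero => rw [gap, measure_univ, gapWeight, ENNReal.ofReal_one]
  | succ n =>
    have hd : Disjoint {k + 1} (Ico (k + 2) (k + 2 + (n + 1 : ℕ))) := by
      rw [disjoint_singleton_left]
      intro h
      have := h.1
      omega
    rw [gap, bernoulliField_inter q hd (measurableSet_cylinderEvents_apply_eq (mem_singleton _) false)
      (measurableSet_noPair (k + 2) (n + 1)), bernoulliField_noPair hq, bernoulliField_apply_false,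
      gapWeight, ENNReal.ofReal_mul (sub_nonneg.2 hq.2.le)]

lemma bernoulliField_gapThen (k : ℤ) (n : ℕ) (b : Bool) :
    bernoulliField q (gapThen k n b) =
      ENNReal.ofReal (spinProb q ((n + 1 : ℕ) : ℕ∞) b) * bernoulliField q (gap k n) := by
  have hg := gFun_mul_gapWeight hq n
  rw [bernoulliField_gap hq, ← ENNReal.ofReal_mul (spinProb_nonneg hq _ _)]
  cases b
  · rw [gapThen, if_neg (by simp), bernoulliField_gap hq, ← hg]
    rfl
  · rw [gapThen, if_pos rfl, measure_sdiff (gap_anti k n)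
      (cylinderEvents_le_pi _ (measurableSet_gap k (n + 1))).nullMeasurableSet
      (measure_ne_top _ _), bernoulliField_gap hq, bernoulliField_gap hq,
      ← ENNReal.ofReal_sub _ (gapWeight_pos hq _).le]
    congr 1
    simp only [spinProb, if_true]
    linarith

omit hq in
lemma lintegral_mul_indicator_of_le_of_gt {k : ℤ} {G : Config → ℝ≥0∞}
    (hG : Measurable[cylinderEvents (Iic k)] G) {C : Set Config}
    (hC : MeasurableSet[cylinderEvents (Ioi k)] C) :
    ∫⁻ ω, G ω * C.indicator 1 ω ∂(bernoulliField q) =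
      (∫⁻ ω, G ω ∂(bernoulliField q)) * bernoulliField q C := by
  rw [ProbabilityTheory.lintegral_mul_eq_lintegral_mul_lintegral_of_independent_measurableSpace
    cylinderEvents_le_pi cylinderEvents_le_pi (indep_cylinderEvents q (Iic_disjoint_Ioi le_rfl))
    hG (measurable_indicator_one hC), lintegral_indicator_one (cylinderEvents_le_pi _ hC)]

/-- Consistency given that the nearest pair of ones is at a given positive distance. -/
lemma setLIntegral_step_of_pair (k : ℤ) (n : ℕ) {f : Config' → ℝ≥0∞}
    (hf : Measurable[sigmaLT (k + n + 1 + 1)] f) :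
    ∫⁻ ω in pairAt k ∩ gap k n, step q (k + n + 1) f (thin' ω) ∂(bernoulliField q) =
      ∫⁻ ω in pairAt k ∩ gap k n, f (thin' ω) ∂(bernoulliField q) := by
  have hfd := spinDependsOn_of_measurable hf
  have hE : MeasurableSet (pairAt k ∩ gap k n) :=
    (cylinderEvents_le_pi _ (measurableSet_pairAt k)).inter
      (cylinderEvents_le_pi _ (measurableSet_gap k n))
  -- On the event, `f` is a function of the spins up to `k` and of the thinned spin `b` at `k + n +
  -- 1`. Both integrands become sums of `G b`, a function of the past, times an indicator of the
  -- independent future; the future probabilities then match by `bernoulliField_gapThen`.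
  set G : Bool → Config → ℝ≥0∞ := fun b =>
    (pairAt k).indicator fun ω => f (thin' (fill k n b ω)) with hGdef
  have hG : ∀ b, Measurable[cylinderEvents (Iic k)] (G b) := fun b =>
    Measurable.indicator (((hf.mono (sigmaOn_le _) le_rfl).comp measurable_thin').comp
      (measurable_fill k n b)) (measurableSet_pairAt k)
  have hfill : ∀ ω ∈ pairAt k ∩ gap k n,
      f (thin' ω) = f (thin' (fill k n ((thin' ω).1 (k + n + 1)) ω)) := by
    intro ω hω
    refine hfd fun j hj => ?_
    rcases eq_or_ne j (k + n + 1) with rfl | hne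
    · rw [thin'_fill_apply_self]
    · have := mem_Iio.1 hj
      rw [thin'_fill_apply hω _ (by omega)]
  have hext : ∀ ω ∈ pairAt k ∩ gap k n, ∀ b,
      f (extend (k + n + 1) (thin' ω) b) = f (thin' (fill k n b ω)) := by
    intro ω hω b
    have hd := (pairDist_thin'_eq_iff k n ω).2 hω
    refine hfd fun j hj => ?_
    rcases eq_or_ne j (k + n + 1) with rfl | hne
    · rw [thin'_fill_apply_self, extend_apply_self]
    · have := mem_Iio.1 hj
      rw [thin'_fill_apply hω _ (by omega), extend_apply_of_lt _ (by omega)]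
      rw [hd]
      exact fun h => absurd h (by simp)
  have h1 : ∀ ω, (pairAt k ∩ gap k n).indicator (fun ω => step q (k + n + 1) f (thin' ω)) ω =
      ∑ b, ENNReal.ofReal (spinProb q ((n + 1 : ℕ) : ℕ∞) b) *
        (G b ω * (gap k n).indicator 1 ω) := by
    intro ω
    by_cases hω : ω ∈ pairAt k ∩ gap k n
    · rw [indicator_of_mem hω, step]
      refine Finset.sum_congr rfl fun b _ => ?_
      rw [weight, (pairDist_thin'_eq_iff k n ω).2 hω, hext ω hω, hGdef]
      simp [hω.1, hω.2]
    · rw [indicator_of_notMem hω]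
      symm
      refine Finset.sum_eq_zero fun b _ => ?_
      rw [mem_inter_iff, not_and_or] at hω
      rcases hω with h | h <;> simp [hGdef, h]
  have h2 : ∀ ω, (pairAt k ∩ gap k n).indicator (fun ω => f (thin' ω)) ω =
      ∑ b, G b ω * (gapThen k n b).indicator 1 ω := by
    intro ω
    by_cases hP : ω ∈ pairAt k
    · have hmem := mem_gapThen_iff (n := n) hP.2
      by_cases hg : ω ∈ gap k n
      · rw [indicator_of_mem (mem_inter hP hg), hfill ω ⟨hP, hg⟩]
        have hc : ∀ b, (gapThen k n b).indicator (1 : Config → ℝ≥0∞) ω =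
            if (thin' ω).1 (k + n + 1) = b then 1 else 0 := by
          intro b
          simp only [indicator, hmem, hg, true_and]
          rfl
        simp only [hc, mul_ite, mul_one, mul_zero, Finset.sum_ite_eq, Finset.mem_univ, if_true]
        simp [hGdef, hP]
      · rw [indicator_of_notMem fun h => hg h.2]
        symm
        refine Finset.sum_eq_zero fun b _ => ?_
        rw [indicator_of_notMem fun h => hg ((hmem b).1 h).1, mul_zero]
    · rw [indicator_of_notMem fun h => hP h.1]
      simp [hGdef, hP]
  have hGm : ∀ b, Measurable (G b) := fun b => (hG b).mono cylinderEvents_le_pi le_rfl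
  have hgm : Measurable ((gap k n).indicator (1 : Config → ℝ≥0∞)) :=
    measurable_indicator_one (cylinderEvents_le_pi _ (measurableSet_gap k n))
  have hgtm : ∀ b, Measurable ((gapThen k n b).indicator (1 : Config → ℝ≥0∞)) := fun b =>
    measurable_indicator_one (cylinderEvents_le_pi _ (measurableSet_gapThen k n b))
  rw [← lintegral_indicator hE, ← lintegral_indicator hE, lintegral_congr h1, lintegral_congr h2,
    lintegral_finsetSum _ fun b _ => ((hGm b).fun_mul hgm).const_mul _,
    lintegral_finsetSum _ fun b _ => (hGm b).fun_mul (hgtm b)]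
  refine Finset.sum_congr rfl fun b _ => ?_
  rw [lintegral_const_mul _ ((hGm b).fun_mul hgm), lintegral_mul_indicator_of_le_of_gt (hG b)
    (measurableSet_gap k n), lintegral_mul_indicator_of_le_of_gt (hG b) (measurableSet_gapThen k n b),
    bernoulliField_gapThen hq]
  ring

omit hq in
-- In `Ω'` a one at `i - 1` with `i - 2` empty forces a one at `i`, and the kernel gives this spin
-- probability `1`.
lemma step_of_pairDist_eq_zero (p : ℝ) {i : ℤ} {f : Config' → ℝ≥0∞}
    (hf : SpinDependsOn f (Iio (i + 1))) {ω : Config'} (h : pairDist ω.1 i = 0) :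
    step p i f ω = f ω := by
  have h0 := pairDist_eq_zero_iff.1 h
  have hi : ω.1 i = true := by
    have := eq_true_or_of_eq_true ω h0.2
    rw [show i - 1 - 1 = i - 2 by ring, h0.1, sub_add_cancel] at this
    simpa using this
  have he : f (extend i ω true) = f ω := by
    refine hf fun j hj => ?_
    rcases eq_or_ne j i with rfl | hne
    · rw [extend_apply_self, hi]
    · have := mem_Iio.1 hj
      exact extend_apply_of_lt (fun _ => rfl) (by omega)
  simp [step, weight, h, spinProb, gFun_zero, he]

/-- Pairs survive thinning, so infinite distance means that no window of the Bernoulli field left of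
`i` contains a pair, an event bounded by `noPairWeight_two_mul_le`. -/
lemma bernoulliField_pairDist_eq_top (i : ℤ) :
    bernoulliField q {ω | pairDist (thin' ω).1 i = ⊤} = 0 := by
  have hle : ∀ n : ℕ, bernoulliField q {ω | pairDist (thin' ω).1 i = ⊤} ≤
      ENNReal.ofReal ((1 - (q : ℝ) ^ 2) ^ n) := by
    intro n
    refine (measure_mono ?_).trans ((bernoulliField_noPair hq (i - (2 * n : ℕ)) (2 * n)).le.trans
      (ENNReal.ofReal_le_ofReal (noPairWeight_two_mul_le hq n)))
    rintro ω hω j hj hj' ⟨ha, hb⟩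
    rw [sub_add_cancel] at hj'
    simp only [mem_ofPred_eq] at hω
    have hne : ¬((thin' ω).1 (i - 2) = false ∧ (thin' ω).1 (i - 1) = true) := by
      rw [← pairDist_eq_zero_iff, hω]
      simp
    rw [pairDist, if_neg hne, iInf₂_eq_top] at hω
    refine absurd (hω (i - j - 1).toNat ⟨by omega, ?_, ?_⟩) (ENat.natCast_ne_top _)
    · rw [show i - ((i - j - 1).toNat : ℤ) - 1 = j by omega, thin'_apply, ha, hb]
      simp
    · rw [show i - ((i - j - 1).toNat : ℤ) = j + 1 by omega, thin'_apply, add_sub_cancel_right,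
        ha, hb]
      simp
  have hlim : Filter.Tendsto (fun n : ℕ => ENNReal.ofReal ((1 - (q : ℝ) ^ 2) ^ n)) Filter.atTop
      (nhds 0) := by
    rw [← ENNReal.ofReal_zero]
    refine ENNReal.tendsto_ofReal (tendsto_pow_atTop_nhds_zero_of_lt_one ?_ ?_)
    · nlinarith [hq.1, hq.2]
    · nlinarith [hq.1, hq.2]
  exact le_antisymm (ge_of_tendsto' hlim hle) zero_le

lemma lintegral_step_thinnedField (i : ℤ) {f : Config' → ℝ≥0∞}
    (hf : Measurable[sigmaLT (i + 1)] f) :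
    ∫⁻ ω, step q i f ω ∂(thinnedField q) = ∫⁻ ω, f ω ∂(thinnedField q) := by
  have hfm : Measurable f := hf.mono (sigmaOn_le _) le_rfl
  have hsm : Measurable (step q i f) := (measurable_step q hf).mono (sigmaOn_le _) le_rfl
  rw [thinnedField, lintegral_map hsm measurable_thin', lintegral_map hfm measurable_thin']
  set N : Config → ℕ∞ := fun ω => pairDist (thin' ω).1 i with hN
  have hNm : Measurable N :=
    ((measurable_pairDist i).mono (sigmaOn_le _) le_rfl).comp measurable_thin'
  have hU : (univ : Set Config) = ⋃ n, N ⁻¹' {n} := by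
    ext ω
    simp
  have hdisj : Pairwise (Function.onFun Disjoint fun n => N ⁻¹' {n}) := fun a b hab =>
    Disjoint.preimage _ (disjoint_singleton.2 hab)
  rw [← setLIntegral_univ, ← setLIntegral_univ (fun ω => f (thin' ω)), hU,
    lintegral_iUnion (fun n => hNm (measurableSet_singleton n)) hdisj,
    lintegral_iUnion (fun n => hNm (measurableSet_singleton n)) hdisj]
  refine tsum_congr fun n => ?_
  induction n using ENat.recTopCoe with
  | top =>
    have h0 : bernoulliField q (N ⁻¹' {⊤}) = 0 := bernoulliField_pairDist_eq_top hq i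
    rw [setLIntegral_measure_zero _ _ h0, setLIntegral_measure_zero _ _ h0]
  | coe n =>
    cases n with
    | zero =>
      refine setLIntegral_congr_fun (hNm (measurableSet_singleton _)) fun ω hω => ?_
      exact step_of_pairDist_eq_zero q (spinDependsOn_of_measurable hf) hω
    | succ n =>
      obtain ⟨k, rfl⟩ : ∃ k : ℤ, i = k + n + 1 := ⟨i - n - 1, by ring⟩
      have : N ⁻¹' {((n + 1 : ℕ) : ℕ∞)} = pairAt k ∩ gap k n := by
        ext ω
        exact pairDist_thin'_eq_iff k n ω
      rw [this]
      exact setLIntegral_step_of_pair hq k n hf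

lemma lintegral_steps_thinnedField (l : ℤ) (k : ℕ) {f : Config' → ℝ≥0∞}
    (hf : Measurable[sigmaLT (l + k)] f) :
    ∫⁻ ω, steps q l k f ω ∂(thinnedField q) = ∫⁻ ω, f ω ∂(thinnedField q) := by
  induction k generalizing f with
  | zero => rfl
  | succ k ih =>
    rw [Nat.cast_succ, ← add_assoc] at hf
    rw [steps, ih (measurable_step q hf), lintegral_step_thinnedField hq _ hf]

lemma isConsistent_thinnedField : IsConsistent (lis q) (thinnedField q) where
  prob := inferInstance
  consistent l m hlm f hf := by
    simp_rw [lintegral_lis hq hlm hf]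
    refine lintegral_steps_thinnedField hq l _ ?_
    rwa [show l + ((m + 1 - l).toNat : ℤ) = m + 1 by omega, ← sigmaLE_eq_sigmaLT]

end Field

end TBF

end

theorem mainTheorem5 (p : ℝ) (hp : p ∈ Set.Ioo (0 : ℝ) 1) :
    TBF.IsLIS (TBF.lis p) ∧
    (∀ (i : ℤ) (ω : TBF.Config'),
      TBF.lis p i i ω {η | η.1 i = false} =
        ENNReal.ofReal (TBF.gFun p (TBF.pairDist ω.1 i))) ∧
    (∀ ν : MeasureTheory.Measure TBF.Config',
      TBF.IsConsistent (TBF.lis p) ν ↔ ν = TBF.thinnedField ⟨p, hp.1.le, hp.2.le⟩) := by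
  have hc : TBF.IsConsistent (TBF.lis p) (TBF.thinnedField ⟨p, hp.1.le, hp.2.le⟩) :=
    TBF.isConsistent_thinnedField (q := ⟨p, hp.1.le, hp.2.le⟩) hp
  refine ⟨TBF.isLIS_lis hp, TBF.lis_single_apply hp, fun ν => ⟨fun hν => hν.unique hp hc, ?_⟩⟩
  rintro rfl
  exact hc
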